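/- Let $M$ be a connected oriented smooth surface and $\mathbf X : M\to\mathbb E^3$ a smooth non-flat minimal immersion with induced metric $g=d\mathbf X\cdot d\mathbf X$, orientation-compatible unit normal $\mathbf N=(\mathbf N^1,\mathbf N^2,\mathbf N^3)$, second fundamental form $A=-d\mathbf N\cdot d\mathbf X$ and Gauss curvature $K$. Endow $M$ with the complex structure induced by $g$ and the orientation. Then the Hopf differential $Q$, the quadratic differential with $\operatorname{Re} Q=A$, is holomorphic, and the stereographically projected Gauss map $G=(\mathbf N^1+i\mathbf N^2)/(1-\mathbf N^3)$ is meromorphic. Let $M'\subset M$ be the complement of the set of umbilic points. On $M'$ let $\nabla$ be the Levi-Civita connection of the metric $\sqrt{-K}\,g$, and write ${}'=\nabla^{1,0}$ for the induced operator from differentials of degree $\ell$ to differentials of degree $\ell+1$: in a local holomorphic coordinate $z$ with $\nabla_{\partial_z}\partial_z=\gamma\,\partial_z$ it is $(s\,dz^\ell)'=(\partial_z s-\ell\gamma s)\,dz^{\ell+1}$. The entropy differentials $P_\ell$, $\ell\ge 2$, are the differentials of degree $\ell$ on $M'$ given by $$P_2=\frac{G'''}{G'}-\frac32\left(\frac{G''}{G'}\right)^2,\qquad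 P_{\ell+1}=(P_\ell)'$$ (at poles of $G$, $P_2$ is computed from $1/G$ instead of $G$). The degree of $\mathbf X$ is the smallest integer $m\ge 2$ such that $P_m$ vanishes identically or $P_m=\psi(P_2,\dots,P_{m-1})$ on $M'$ for a non-zero complex polynomial $\psi$ that is weighted-homogeneous of degree $m$ in variables of weights $2,\dots,m-1$. Suppose that $\mathbf X$ has degree four and that $Q$ vanishes to order $n\in\mathbb N$ at some umbilic point. Then $Q$ vanishes to order $n$ at every umbilic point, and on $M'$ $$P_4+\frac{12(n+2)^2}{3n^2+4n}\,(P_2)^2=0 .$$ -/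

import Mathlib

open scoped Manifold ContDiff

noncomputable section

namespace EntropyDifferential

/-- Euclidean three-space. -/
abbrev E3 : Type := EuclideanSpace ℝ (Fin 3)

/-- The positively oriented standard basis `(1, i)` of the real vector space `ℂ`. -/
def stdVec : Fin 2 → ℂ := ![1, Complex.I]

/-! ### Oriented smooth surfaces

A smooth surface is a `C^∞` manifold modelled on the real plane `ℂ`; an orientation is given by an
atlas all of whose transition maps have positive Jacobian determinant.  Since
`TangentSpace 𝓘(ℝ, ℂ) p` is identified with `ℂ` through a chart of that atlas, `(1, i)` is then a
positively oriented basis of every tangent space. -/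

/-- The atlas of `M` is oriented. -/
class OrientedAtlas (M : Type*) [TopologicalSpace M] [ChartedSpace ℂ M] : Prop where
  det_pos : ∀ e ∈ atlas ℂ M, ∀ e' ∈ atlas ℂ M, ∀ w ∈ (e.symm ≫ₕ e').source,
    0 < (fderiv ℝ (e.symm ≫ₕ e') w).det

section Surface

variable {M : Type*} [TopologicalSpace M] [ChartedSpace ℂ M]

/-- The differential of `Y : M → E3` at `p`, as a linear map from the tangent space to `E3`. -/
def diff (Y : M → E3) (p : M) : TangentSpace 𝓘(ℝ, ℂ) p →L[ℝ] E3 :=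
  mfderiv 𝓘(ℝ, ℂ) 𝓘(ℝ, E3) Y p

/-- The cross product of `E3`. -/
def cross (v w : E3) : E3 := WithLp.toLp 2 (crossProduct v.ofLp w.ofLp)

/-- The orientation compatible Gauss map `N = (dX e₁ × dX e₂) / ‖dX e₁ × dX e₂‖`, for a positively
oriented basis `(e₁, e₂)` of the tangent space. -/
def gaussMap (X : M → E3) (p : M) : E3 :=
  let c := cross (diff X p (stdVec 0)) (diff X p (stdVec 1))
  ‖c‖⁻¹ • c

/-- The induced metric `g = dX · dX`. -/
def inducedMetric (X : M → E3) (p : M) (v w : TangentSpace 𝓘(ℝ, ℂ) p) : ℝ :=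
  inner ℝ (diff X p v) (diff X p w)

/-- The second fundamental form `A = -dN · dX`. -/
def secondForm (X : M → E3) (p : M) (v w : TangentSpace 𝓘(ℝ, ℂ) p) : ℝ :=
  -inner ℝ (diff (gaussMap X) p v) (diff X p w)

/-- The matrix, in the basis `stdVec` of the tangent space, of the Weingarten shape operator `S`,
the endomorphism with `A(v, w) = g(S v, w) = g(v, S w)`. -/
def shapeOperator (X : M → E3) (p : M) : Matrix (Fin 2) (Fin 2) ℝ :=
  (Matrix.of fun i j => inducedMetric X p (stdVec i) (stdVec j))⁻¹ *
    Matrix.of fun i j => secondForm X p (stdVec i) (stdVec j)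

/-- The mean curvature `H = tr S / 2`. -/
def meanCurvature (X : M → E3) (p : M) : ℝ := (shapeOperator X p).trace / 2

/-- The Gauss curvature `K = det S`, the product of the principal curvatures. -/
def gaussCurvature (X : M → E3) (p : M) : ℝ := (shapeOperator X p).det

/-- `p` is an umbilic point: the principal curvatures agree, i.e. `S` is a multiple of the
identity. -/
def IsUmbilic (X : M → E3) (p : M) : Prop :=
  ∃ κ : ℝ, shapeOperator X p = κ • (1 : Matrix (Fin 2) (Fin 2) ℝ)

/-- `X` is a smooth minimal immersion. -/
structure IsMinimalImmersion (X : M → E3) : Prop where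
  smooth : ContMDiff 𝓘(ℝ, ℂ) 𝓘(ℝ, E3) ∞ X
  immersion : ∀ p, Function.Injective (diff X p)
  minimal : ∀ p, meanCurvature X p = 0

/-! ### Local holomorphic coordinates -/

/-- The coordinate vectors `∂_x` (`i = 0`) and `∂_y` (`i = 1`) of the local coordinate
`z = x + iy`, at the point with coordinate `w`. -/
def coordVec (z : OpenPartialHomeomorph M ℂ) (w : ℂ) (i : Fin 2) :
    TangentSpace 𝓘(ℝ, ℂ) (z.symm w) :=
  mfderiv 𝓘(ℝ, ℂ) 𝓘(ℝ, ℂ) z.symm w (stdVec i)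

/-- `z` is a local holomorphic coordinate for the complex structure on `M` induced by the metric
`g = dX · dX` and the orientation, i.e. an orientation preserving conformal smooth chart. -/
structure IsHolomorphicCoord [IsManifold 𝓘(ℝ, ℂ) ∞ M] (X : M → E3)
    (z : OpenPartialHomeomorph M ℂ) : Prop where
  smooth : z ∈ IsManifold.maximalAtlas 𝓘(ℝ, ℂ) ∞ M
  oriented : ∀ e ∈ atlas ℂ M, ∀ w ∈ (z.symm ≫ₕ e).source, 0 < (fderiv ℝ (z.symm ≫ₕ e) w).det
  conformal : ∀ w ∈ z.target,
    inducedMetric X (z.symm w) (coordVec z w 0) (coordVec z w 0) =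
      inducedMetric X (z.symm w) (coordVec z w 1) (coordVec z w 1) ∧
    inducedMetric X (z.symm w) (coordVec z w 0) (coordVec z w 1) = 0

/-- The coefficient `q` of the Hopf differential `Q = q dz²`, the quadratic differential (section
of the square of the canonical bundle) with real part `A`.  Explicitly
`Q(v, w) = A(v, w) - i A(J v, w)`, so that `q = Q(∂_x, ∂_x)` with `J ∂_x = ∂_y`. -/
def hopfCoeff (X : M → E3) (z : OpenPartialHomeomorph M ℂ) (w : ℂ) : ℂ :=
  (secondForm X (z.symm w) (coordVec z w 0) (coordVec z w 0) : ℂ) -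
    Complex.I * (secondForm X (z.symm w) (coordVec z w 1) (coordVec z w 0) : ℂ)

/-- The Hopf differential of `X` vanishes at `p` to order exactly `n`: its coefficient in a local
holomorphic coordinate around `p` does. -/
def HopfVanishesToOrder [IsManifold 𝓘(ℝ, ℂ) ∞ M] (X : M → E3) (p : M) (n : ℕ) : Prop :=
  ∃ z : OpenPartialHomeomorph M ℂ, IsHolomorphicCoord X z ∧ p ∈ z.source ∧
    AnalyticAt ℂ (hopfCoeff X z) (z p) ∧ analyticOrderAt (hopfCoeff X z) (z p) = n

/-! ### The Levi-Civita connection of the flat metric `√(-K) g` -/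

/-- The components of `g₀ = √(-K) g` in the local coordinate `z`. -/
def flatMetric (X : M → E3) (z : OpenPartialHomeomorph M ℂ) (w : ℂ) : Matrix (Fin 2) (Fin 2) ℝ :=
  Matrix.of fun i j => √(-gaussCurvature X (z.symm w)) *
    inducedMetric X (z.symm w) (coordVec z w i) (coordVec z w j)

/-- The partial derivative `∂_k h_{ij}` of the components of a metric on a plane domain. -/
def metricDeriv (h : ℂ → Matrix (Fin 2) (Fin 2) ℝ) (w : ℂ) (k i j : Fin 2) : ℝ :=
  fderiv ℝ (fun v => h v i j) w (stdVec k)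

/-- The Christoffel symbols `Γ^k_{ij}` of the Levi-Civita connection of a metric `h`. -/
def christoffel (h : ℂ → Matrix (Fin 2) (Fin 2) ℝ) (w : ℂ) (k i j : Fin 2) : ℝ :=
  (1 / 2) * ∑ l, (h w)⁻¹ k l *
    (metricDeriv h w i j l + metricDeriv h w j i l - metricDeriv h w l i j)

/-- The function `γ` with `∇_{∂_z} ∂_z = γ ∂_z`, where `∂_z = (∂_x - i ∂_y) / 2` and `∇` is the
Levi-Civita connection, extended complex-linearly, of the metric `g₀ = √(-K) g`.  Since
`∇_{∂_z} ∂_z = (∇_{∂_x} ∂_x - ∇_{∂_y} ∂_y - 2 i ∇_{∂_x} ∂_y) / 4`, this is read off from the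
`∂_x`-components. -/
def gammaCoeff (X : M → E3) (z : OpenPartialHomeomorph M ℂ) (w : ℂ) : ℂ :=
  let Γ := christoffel (flatMetric X z) w
  (1 / 2) * ((Γ 0 0 0 : ℂ) - (Γ 0 1 1 : ℂ) - 2 * Complex.I * (Γ 0 0 1 : ℂ))

/-! ### Entropy differentials -/

/-- The Wirtinger derivative `∂_z = (∂_x - i ∂_y) / 2`. -/
def wirtinger (s : ℂ → ℂ) (w : ℂ) : ℂ :=
  (1 / 2) * (fderiv ℝ s w 1 - Complex.I * fderiv ℝ s w Complex.I)

/-- `∇^{1,0} (s dz^ℓ) = (∂_z s - ℓ γ s) dz^{ℓ+1}`, on coefficients. -/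
def nablaOneZero (γ : ℂ → ℂ) (ℓ : ℕ) (s : ℂ → ℂ) (w : ℂ) : ℂ :=
  wirtinger s w - ℓ * γ w * s w

/-- The coefficient of the Schwarzian derivative `f'''/f' - (3/2) (f''/f')²`, the primes being
covariant derivatives `∇^{1,0}`. -/
def schwarzian (γ f : ℂ → ℂ) (w : ℂ) : ℂ :=
  let f₁ := nablaOneZero γ 0 f
  let f₂ := nablaOneZero γ 1 f₁
  let f₃ := nablaOneZero γ 2 f₂
  f₃ w / f₁ w - (3 / 2) * (f₂ w / f₁ w) ^ 2

/-- The stereographically projected Gauss map `G = (N¹ + i N²) / (1 - N³)`, where it is finite. -/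
def stereoGauss (X : M → E3) (p : M) : ℂ :=
  ((gaussMap X p 0 : ℂ) + Complex.I * (gaussMap X p 1 : ℂ)) / (1 - (gaussMap X p 2 : ℂ))

/-- The reciprocal `1 / G = (N¹ - i N²) / (1 + N³)`, which is regular at the poles of `G`. -/
def stereoGaussInv (X : M → E3) (p : M) : ℂ :=
  ((gaussMap X p 0 : ℂ) - Complex.I * (gaussMap X p 1 : ℂ)) / (1 + (gaussMap X p 2 : ℂ))

open Classical in
/-- The Schwarzian derivative of the meromorphic function `G`: at a pole of `G`, where `N³ = 1`, it
is computed from `1 / G`, as usual. -/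
def schwarzianGauss (X : M → E3) (z : OpenPartialHomeomorph M ℂ) (w : ℂ) : ℂ :=
  if gaussMap X (z.symm w) 2 = 1 then
    schwarzian (gammaCoeff X z) (fun v => stereoGaussInv X (z.symm v)) w
  else schwarzian (gammaCoeff X z) (fun v => stereoGauss X (z.symm v)) w

/-- The coefficient `p_ℓ` of the entropy differential `P_ℓ = p_ℓ dz^ℓ`, `ℓ ≥ 2`, in the local
holomorphic coordinate `z`: `P₂` is the Schwarzian derivative of `G` with respect to the Levi-Civita
connection of `√(-K) g`, and `P_{ℓ+1} = ∇^{1,0} P_ℓ`.  It is meaningful away from umbilic points;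
the values for `ℓ < 2` are placeholders. -/
def entropyCoeff (X : M → E3) (z : OpenPartialHomeomorph M ℂ) : ℕ → ℂ → ℂ
  | 0 => 0
  | 1 => 0
  | 2 => schwarzianGauss X z
  | (k + 3) => nablaOneZero (gammaCoeff X z) (k + 2) (entropyCoeff X z (k + 2))

variable [IsManifold 𝓘(ℝ, ℂ) ∞ M]

/-- An identity between differentials holds on the complement `M'` of the umbilic locus: the
corresponding identity of coefficients holds in every local holomorphic coordinate, at every point
that is not umbilic. -/
def HoldsOffUmbilics (X : M → E3) (R : OpenPartialHomeomorph M ℂ → ℂ → Prop) : Prop :=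
  ∀ z : OpenPartialHomeomorph M ℂ, IsHolomorphicCoord X z →
    ∀ w ∈ z.target, ¬ IsUmbilic X (z.symm w) → R z w

/-- `P_m` vanishes identically, or `P_m = ψ(P₂, …, P_{m-1})` for a weighted-homogeneous complex
polynomial `ψ ≠ 0` of degree `m` in variables of weights `2, …, m - 1`. -/
def DegreeRelation (X : M → E3) (m : ℕ) : Prop :=
  HoldsOffUmbilics X (fun z w => entropyCoeff X z m w = 0) ∨
  ∃ ψ : MvPolynomial (Fin (m - 2)) ℂ, ψ ≠ 0 ∧
    ψ.IsWeightedHomogeneous (fun i : Fin (m - 2) => (i : ℕ) + 2) m ∧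
    HoldsOffUmbilics X (fun z w =>
      entropyCoeff X z m w = 
        MvPolynomial.eval (fun i : Fin (m - 2) => entropyCoeff X z ((i : ℕ) + 2) w) ψ)

/-- The immersion `X` is non-flat and has degree `n`: `n` is the smallest integer `m ≥ 2` for which
`P_m` is zero or a weighted-homogeneous polynomial in the lower order entropy differentials. -/
structure HasDegree (X : M → E3) (n : ℕ) : Prop where
  nonflat : ∃ p, gaussCurvature X p ≠ 0
  isLeast : IsLeast {m : ℕ | 2 ≤ m ∧ DegreeRelation X m} n

end Surface

end EntropyDifferential

end

open scoped Manifold ContDiff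

noncomputable section

namespace EntropyDifferential

/-! ### Vector algebra in Euclidean three-space -/

/-! A polynomial of weighted degree four in variables of weights 2 and 3 is a multiple of the square
of the first variable, so degree four means `P₄ = c P₂²` on `M'` for one constant `c`
(`DegreeRelation.exists_coeff`). This relation is compared with the leading Laurent coefficients at
an umbilic point.

In a holomorphic coordinate `Q = q dz²` with `q` holomorphic, the metric `√(-K) g` is `|q| |dz|²`,
and therefore `γ = q'/(2q)` (`IsHolomorphicCoord.gammaCoeff_eq`). The Weierstrass data give `G' = q
v` with `v` holomorphic and nonvanishing; at a pole of `G` the same holds for `1/G`, which has the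
same Schwarzian. If `q` vanishes to order `n` at `z₀`, then `P₂` has leading term `a (z - z₀)⁻²`
with `a = -(3n² + 4n)/8` (`schwarzian_laurent`), and applying `∇^{1,0}` to a coefficient with a pole
of order `ℓ` multiplies the leading coefficient by `-ℓ(n + 2)/2` (`nablaOneZero_laurent`). So `P₄`
has leading coefficient `(3/2)(n + 2)² a`, and the relation gives `(3/2)(n + 2)² a = c a²`. An
umbilic point has `n ≥ 1`, hence `a ≠ 0` and `c = -12(n + 2)²/(3n² + 4n)`. This value is injective
in `n ≥ 1` (`orders_eq_of_relation`), so all umbilic points have the same order.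

Two geometric facts support the computation. Isothermal coordinates exist: on a minimal surface the
form `N × dX` is closed, so a coordinate function has a local harmonic conjugate, and the two
together form a conformal chart (`exists_isHolomorphicCoord`). On a connected non-flat surface `q`
vanishes identically near no point, by the identity theorem, so every order is finite
(`not_eventually_umbilic`). -/

theorem inner_eq_coord (v w : E3) : inner ℝ v w = v 0 * w 0 + v 1 * w 1 + v 2 * w 2 := by
  simp [PiLp.inner_apply, Fin.sum_univ_three, mul_comm]

theorem cross_coord_zero (v w : E3) : cross v w 0 = v 1 * w 2 - v 2 * w 1 := rfl

theorem cross_coord_one (v w : E3) : cross v w 1 = v 2 * w 0 - v 0 * w 2 := rfl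

theorem cross_coord_two (v w : E3) : cross v w 2 = v 0 * w 1 - v 1 * w 0 := rfl

theorem ext_coord {v w : E3} (h0 : v 0 = w 0) (h1 : v 1 = w 1) (h2 : v 2 = w 2) : v = w := by
  ext i
  fin_cases i
  · exact h0
  · exact h1
  · exact h2

/-- The cross product as a continuous bilinear map. -/
def crossL : E3 →L[ℝ] E3 →L[ℝ] E3 :=
  LinearMap.toContinuousBilinearMap (LinearMap.mk₂ ℝ cross
    (fun a b c => by
      apply ext_coord <;>
        simp only [PiLp.add_apply, cross_coord_zero, cross_coord_one, cross_coord_two] <;> ring)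
    (fun r a b => by
      apply ext_coord <;>
        simp only [PiLp.smul_apply, smul_eq_mul, cross_coord_zero, cross_coord_one,
          cross_coord_two] <;> ring)
    (fun a b c => by
      apply ext_coord <;>
        simp only [PiLp.add_apply, cross_coord_zero, cross_coord_one, cross_coord_two] <;> ring)
    (fun r a b => by
      apply ext_coord <;>
        simp only [PiLp.smul_apply, smul_eq_mul, cross_coord_zero, cross_coord_one,
          cross_coord_two] <;> ring))

@[simp] theorem crossL_apply (v w : E3) : crossL v w = cross v w := rfl

theorem cross_lin_comb (a b : E3) (r s t u : ℝ) :
    cross (r • a + s • b) (t • a + u • b) = (r * u - s * t) • cross a b := by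
  apply ext_coord <;>
    simp only [PiLp.add_apply, PiLp.smul_apply, smul_eq_mul, cross_coord_zero, cross_coord_one,
      cross_coord_two] <;> ring

theorem inner_cross_left (a b : E3) : inner ℝ (cross a b) a = (0 : ℝ) := by
  simp only [inner_eq_coord, cross_coord_zero, cross_coord_one, cross_coord_two]; ring

theorem inner_cross_right (a b : E3) : inner ℝ (cross a b) b = (0 : ℝ) := by
  simp only [inner_eq_coord, cross_coord_zero, cross_coord_one, cross_coord_two]; ring

/-- Lagrange's identity. -/
theorem inner_cross_self (a b : E3) :
    inner ℝ (cross a b) (cross a b) =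
      inner ℝ a a * inner ℝ b b - (inner ℝ a b : ℝ) ^ 2 := by
  simp only [inner_eq_coord, cross_coord_zero, cross_coord_one, cross_coord_two]; ring

theorem eq_zero_of_inner_frame {a b V : E3} (hc : cross a b ≠ 0) (ha : inner ℝ V a = (0 : ℝ))
    (hb : inner ℝ V b = (0 : ℝ)) (hV : inner ℝ V (cross a b) = (0 : ℝ)) : V = 0 := by
  have hpos : inner ℝ (cross a b) (cross a b) ≠ (0 : ℝ) := by simpa using hc
  simp only [inner_eq_coord, cross_coord_zero, cross_coord_one, cross_coord_two] at ha hb hV hpos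
  apply ext_coord <;> rw [PiLp.zero_apply] <;> apply (mul_eq_zero_iff_right hpos).mp
  -- With `c = a × b`, the reciprocal basis expansion is `|c|² V = (V·a)(b × c) + (V·b)(c × a) +
  -- (V·c) c`; the coefficients are the coordinates of these three vectors.
  · linear_combination ha * (b 1 * (a 0 * b 1 - a 1 * b 0) - b 2 * (a 2 * b 0 - a 0 * b 2)) +
      hb * ((a 2 * b 0 - a 0 * b 2) * a 2 - (a 0 * b 1 - a 1 * b 0) * a 1) +
      hV * (a 1 * b 2 - a 2 * b 1)
  · linear_combination ha * (b 2 * (a 1 * b 2 - a 2 * b 1) - b 0 * (a 0 * b 1 - a 1 * b 0)) +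
      hb * ((a 0 * b 1 - a 1 * b 0) * a 0 - (a 1 * b 2 - a 2 * b 1) * a 2) +
      hV * (a 2 * b 0 - a 0 * b 2)
  · linear_combination ha * (b 0 * (a 2 * b 0 - a 0 * b 2) - b 1 * (a 1 * b 2 - a 2 * b 1)) +
      hb * ((a 1 * b 2 - a 2 * b 1) * a 1 - (a 2 * b 0 - a 0 * b 2) * a 0) +
      hV * (a 0 * b 1 - a 1 * b 0)

/-- If `n₁, n₂` are tangent to the plane spanned by `a, b` and the trace of the second fundamental
form `-(nᵢ · aⱼ)` vanishes, then `n₁ × b = n₂ × a`. -/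
theorem cross_eq_cross_of_trace {a b n₁ n₂ : E3} (hc : cross a b ≠ 0)
    (h1 : inner ℝ n₁ (cross a b) = (0 : ℝ)) (h2 : inner ℝ n₂ (cross a b) = (0 : ℝ))
    (htr : (inner ℝ n₁ a * inner ℝ b b - inner ℝ n₁ b * inner ℝ a b - inner ℝ n₂ a * inner ℝ a b +
      inner ℝ n₂ b * inner ℝ a a : ℝ) = 0) :
    cross n₁ b = cross n₂ a := by
  rw [← sub_eq_zero]
  simp only [inner_eq_coord, cross_coord_zero, cross_coord_one, cross_coord_two] at h1 h2 htr
  apply eq_zero_of_inner_frame hc <;>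
    simp only [inner_eq_coord, PiLp.sub_apply, cross_coord_zero, cross_coord_one, cross_coord_two]
  · linear_combination -h1
  · linear_combination -h2
  · linear_combination htr

/-- The unit normal of the oriented plane spanned by `a, b`. -/
def unitNormal (a b : E3) : E3 := ‖cross a b‖⁻¹ • cross a b

theorem inner_unitNormal_left (a b : E3) : inner ℝ (unitNormal a b) a = (0 : ℝ) := by
  simp [unitNormal, inner_smul_left, inner_cross_left]

theorem inner_unitNormal_right (a b : E3) : inner ℝ (unitNormal a b) b = (0 : ℝ) := by
  simp [unitNormal, inner_smul_left, inner_cross_right]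

theorem inner_unitNormal_self {a b : E3} (hc : cross a b ≠ 0) :
    inner ℝ (unitNormal a b) (unitNormal a b) = (1 : ℝ) := by
  rw [real_inner_self_eq_norm_sq, unitNormal, norm_smul, norm_inv, norm_norm,
    inv_mul_cancel₀ (norm_ne_zero_iff.mpr hc), one_pow]

/-- The normal depends only on the oriented plane. This allows `gaussMap`, defined through the
preferred chart at each point, to be computed in any oriented chart. -/
theorem unitNormal_lin_comb (a b : E3) {r s t u : ℝ} (h : 0 < r * u - s * t) :
    unitNormal (r • a + s • b) (t • a + u • b) = unitNormal a b := by
  rw [unitNormal, cross_lin_comb, norm_smul, smul_smul, Real.norm_of_nonneg h.le, unitNormal]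
  congr 1
  field_simp

theorem cross_eq_norm_smul_unitNormal {a b : E3} (hc : cross a b ≠ 0) :
    cross a b = ‖cross a b‖ • unitNormal a b := by
  rw [unitNormal, smul_smul, mul_inv_cancel₀ (norm_ne_zero_iff.mpr hc), one_smul]

theorem norm_cross_of_conformal {a b : E3} (h : inner ℝ a a = (inner ℝ b b : ℝ))
    (h0 : inner ℝ a b = (0 : ℝ)) : ‖cross a b‖ = inner ℝ a a := by
  have h1 := inner_cross_self a b
  rw [h0, ← h, real_inner_self_eq_norm_sq (cross a b)] at h1
  have h2 : (0 : ℝ) ≤ inner ℝ a a := real_inner_self_nonneg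
  nlinarith [norm_nonneg (cross a b), sq_nonneg (‖cross a b‖ - inner ℝ a a),
    sq_nonneg (‖cross a b‖ + inner ℝ a a)]

/-- On a conformal frame `N ×` is the quarter turn `a ↦ b`, `b ↦ -a`, that is, the complex structure
of the tangent plane. -/
theorem cross_unitNormal_left {a b : E3} (hc : cross a b ≠ 0)
    (h : inner ℝ a a = (inner ℝ b b : ℝ)) (h0 : inner ℝ a b = (0 : ℝ)) :
    cross (unitNormal a b) a = b := by
  have hn := norm_cross_of_conformal h h0
  have hne : ‖cross a b‖ ≠ 0 := norm_ne_zero_iff.mpr hc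
  have key : crossL (cross a b) a = ‖cross a b‖ • b := by
    rw [hn]
    simp only [inner_eq_coord] at h h0 ⊢
    apply ext_coord <;> simp only [crossL_apply, PiLp.smul_apply, smul_eq_mul, cross_coord_zero,
      cross_coord_one, cross_coord_two]
    · linear_combination -a 0 * h0
    · linear_combination -a 1 * h0
    · linear_combination -a 2 * h0
  rw [← crossL_apply, unitNormal, map_smul, smul_apply, key, smul_smul,
    inv_mul_cancel₀ hne, one_smul]

theorem cross_unitNormal_right {a b : E3} (hc : cross a b ≠ 0)
    (h : inner ℝ a a = (inner ℝ b b : ℝ)) (h0 : inner ℝ a b = (0 : ℝ)) :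
    cross (unitNormal a b) b = -a := by
  have hn := norm_cross_of_conformal h h0
  have hne : ‖cross a b‖ ≠ 0 := norm_ne_zero_iff.mpr hc
  have key : crossL (cross a b) b = ‖cross a b‖ • (-a) := by
    rw [hn, h]
    simp only [inner_eq_coord] at h h0 ⊢
    apply ext_coord <;> simp only [crossL_apply, PiLp.smul_apply, PiLp.neg_apply, smul_eq_mul,
      cross_coord_zero, cross_coord_one, cross_coord_two]
    · linear_combination b 0 * h0
    · linear_combination b 1 * h0
    · linear_combination b 2 * h0
  rw [← crossL_apply, unitNormal, map_smul, smul_apply, key, smul_smul,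
    inv_mul_cancel₀ hne, one_smul]

/-- The Jacobian of the map with differential `v ↦ v_k - i (ν × v)_k` on the plane spanned by
`a, b`. -/
theorem conj_jacobian (a b : E3) (k : Fin 3) :
    ‖cross a b‖ * (-a k * cross (unitNormal a b) b k + b k * cross (unitNormal a b) a k) =
      inner ℝ (cross a b) (cross a b) - cross a b k ^ 2 := by
  by_cases hc : cross a b = 0
  · simp [hc]
  have hne : ‖cross a b‖ ≠ 0 := norm_ne_zero_iff.mpr hc
  have h (v : E3) : cross (unitNormal a b) v k = ‖cross a b‖⁻¹ * cross (cross a b) v k := by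
    rw [← crossL_apply, unitNormal, map_smul]; rfl
  rw [h, h]
  have : ‖cross a b‖ * (-a k * (‖cross a b‖⁻¹ * cross (cross a b) b k) +
      b k * (‖cross a b‖⁻¹ * cross (cross a b) a k)) =
      -a k * cross (cross a b) b k + b k * cross (cross a b) a k := by
    field_simp
  rw [this]
  fin_cases k <;> simp only [inner_eq_coord, Fin.zero_eta, Fin.mk_one, Fin.reduceFinMk,
    cross_coord_zero, cross_coord_one, cross_coord_two] <;> ring

/-- Otherwise summing over the three coordinates would give `3|c|² ≤ |c|²` for `c = a × b`. The
index found is a coordinate axis not parallel to the normal. -/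
theorem exists_cross_coord_sq_lt {a b : E3} (hc : cross a b ≠ 0) :
    ∃ k, cross a b k ^ 2 < inner ℝ (cross a b) (cross a b) := by
  by_contra! h
  have hpos : 0 < (inner ℝ (cross a b) (cross a b) : ℝ) := by
    rw [real_inner_self_eq_norm_sq]; have := norm_pos_iff.mpr hc; positivity
  have h0 := h 0
  have h1 := h 1
  have h2 := h 2
  rw [inner_eq_coord] at h0 h1 h2 hpos
  nlinarith

/-! ### Oriented charts -/

theorem det_eq_coord (L : ℂ →L[ℝ] ℂ) :
    L.det = (L 1).re * (L Complex.I).im - (L 1).im * (L Complex.I).re := by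
  rw [ContinuousLinearMap.det, ← LinearMap.det_toMatrix Complex.basisOneI, Matrix.det_fin_two]
  simp [LinearMap.toMatrix_apply]
  ring

theorem apply_eq_re_im {F : Type*} [NormedAddCommGroup F] [NormedSpace ℝ F] (L : ℂ →L[ℝ] F)
    (v : ℂ) : L v = v.re • L 1 + v.im • L Complex.I := by
  rw [← map_smul, ← map_smul, ← map_add]
  congr 1
  apply Complex.ext <;> simp

section OrientedCharts

variable {M : Type*} [TopologicalSpace M] [ChartedSpace ℂ M]

/-- `z` is an orientation preserving smooth chart. -/
structure IsOrientedChart (z : OpenPartialHomeomorph M ℂ) : Prop where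
  smooth : z ∈ IsManifold.maximalAtlas 𝓘(ℝ, ℂ) ∞ M
  oriented : ∀ e ∈ atlas ℂ M, ∀ w ∈ (z.symm ≫ₕ e).source, 0 < (fderiv ℝ (z.symm ≫ₕ e) w).det

theorem IsHolomorphicCoord.isOrientedChart [IsManifold 𝓘(ℝ, ℂ) ∞ M] {X : M → E3}
    {z : OpenPartialHomeomorph M ℂ}
    (hz : IsHolomorphicCoord X z) : IsOrientedChart z :=
  ⟨hz.smooth, hz.oriented⟩

theorem isOrientedChart_chartAt [IsManifold 𝓘(ℝ, ℂ) ∞ M] [OrientedAtlas M] (p : M) :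
    IsOrientedChart (chartAt ℂ p) where
  smooth := IsManifold.chart_mem_maximalAtlas p
  oriented e he w hw := OrientedAtlas.det_pos _ (chart_mem_atlas ℂ p) e he w hw

/-- The derivative of `Y` in the direction of the `i`-th coordinate. -/
def pd (Y : ℂ → E3) (i : Fin 2) (w : ℂ) : E3 := fderiv ℝ Y w (stdVec i)

variable {X : M → E3} {z : OpenPartialHomeomorph M ℂ} {w : ℂ}

theorem IsOrientedChart.mdifferentiableAt_symm (hz : IsOrientedChart z) (hw : w ∈ z.target) :
    MDifferentiableAt 𝓘(ℝ, ℂ) 𝓘(ℝ, ℂ) z.symm w :=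
  (contMDiffAt_symm_of_mem_maximalAtlas hz.smooth hw).mdifferentiableAt (by simp)

theorem IsOrientedChart.contDiffAt_comp_symm (hz : IsOrientedChart z)
    (hX : ContMDiff 𝓘(ℝ, ℂ) 𝓘(ℝ, E3) ∞ X) (hw : w ∈ z.target) :
    ContDiffAt ℝ ∞ (fun v => X (z.symm v)) w :=
  ((hX _).comp w (contMDiffAt_symm_of_mem_maximalAtlas hz.smooth hw)).contDiffAt

theorem IsOrientedChart.diff_coordVec (hz : IsOrientedChart z) (hw : w ∈ z.target) {Y : M → E3}
    (hY : MDifferentiableAt 𝓘(ℝ, ℂ) 𝓘(ℝ, E3) Y (z.symm w)) (i : Fin 2) :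
    diff Y (z.symm w) (coordVec z w i) = pd (fun v => Y (z.symm v)) i w := by
  have h := mfderiv_comp w hY (hz.mdifferentiableAt_symm hw)
  rw [mfderiv_eq_fderiv] at h
  rw [pd, show (fun v => Y (z.symm v)) = Y ∘ z.symm from rfl, h]
  rfl

/-- The tangent space at a point is identified with `ℂ` through `chartAt`, so coordinate vectors are
columns of the Jacobian of a transition map, and `oriented` applies to them. -/
theorem IsOrientedChart.coordVec_eq (hz : IsOrientedChart z) (hw : w ∈ z.target) (i : Fin 2) :
    coordVec z w i = fderiv ℝ (z.symm ≫ₕ chartAt ℂ (z.symm w)) w (stdVec i) := by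
  have h := (hz.mdifferentiableAt_symm hw).mfderiv
  rw [coordVec, h]
  simp [writtenInExtChartAt, fderivWithin_univ]
  rfl

theorem IsOrientedChart.coord_det_pos (hz : IsOrientedChart z) (hw : w ∈ z.target) :
    0 < Complex.re (coordVec z w 0) * Complex.im (coordVec z w 1) -
      Complex.im (coordVec z w 0) * Complex.re (coordVec z w 1) := by
  have h := hz.oriented _ (chart_mem_atlas ℂ (z.symm w)) w (by simp [hw])
  rw [det_eq_coord] at h
  rw [hz.coordVec_eq hw, hz.coordVec_eq hw]
  exact h

theorem diff_eq_re_im (Y : M → E3) (p : M) (v : TangentSpace 𝓘(ℝ, ℂ) p) :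
    diff Y p v = Complex.re v • diff Y p (stdVec 0) + Complex.im v • diff Y p (stdVec 1) :=
  apply_eq_re_im (F := E3) (diff Y p) v

theorem IsOrientedChart.pd_eq (hz : IsOrientedChart z) (hw : w ∈ z.target) {Y : M → E3}
    (hY : MDifferentiableAt 𝓘(ℝ, ℂ) 𝓘(ℝ, E3) Y (z.symm w)) (i : Fin 2) :
    pd (fun v => Y (z.symm v)) i w = Complex.re (coordVec z w i) • diff Y (z.symm w) (stdVec 0) +
      Complex.im (coordVec z w i) • diff Y (z.symm w) (stdVec 1) := by
  rw [← hz.diff_coordVec hw hY, ← diff_eq_re_im]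

theorem cross_diff_ne_zero (hX : IsMinimalImmersion X) (p : M) :
    cross (diff X p (stdVec 0)) (diff X p (stdVec 1)) ≠ 0 := by
  intro h
  have hsq := inner_cross_self (diff X p (stdVec 0)) (diff X p (stdVec 1))
  set a := diff X p (stdVec 0) with ha
  set b := diff X p (stdVec 1) with hb
  rw [h, inner_zero_left] at hsq
  -- The vector `|b|² e₁ - (a·b) e₂` has image of squared length `|b|² (|a|²|b|² - (a·b)²)`, which
  -- is zero when `a × b = 0`. Injectivity then forces `|b|² = 0`, so `e₂` lies in the kernel as
  -- well.
  have hcomb : diff X p (⟨inner ℝ b b, -inner ℝ a b⟩ : ℂ) = 0 := by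
    refine (diff_eq_re_im X p (⟨inner ℝ b b, -inner ℝ a b⟩ : ℂ)).trans ?_
    change (inner ℝ b b : ℝ) • a + (-inner ℝ a b : ℝ) • b = 0
    rw [← inner_self_eq_zero (𝕜 := ℝ)]
    simp only [inner_add_left, inner_add_right, inner_smul_left, inner_smul_right,
      real_inner_comm a b, RCLike.conj_to_real]
    linear_combination -(inner ℝ b b : ℝ) * hsq
  have h0 := hX.immersion p (hcomb.trans (map_zero (diff X p)).symm)
  have hbb : (inner ℝ b b : ℝ) = 0 := congrArg Complex.re h0
  rw [inner_self_eq_zero (𝕜 := ℝ)] at hbb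
  have h1 := hX.immersion p (hbb.trans (map_zero (diff X p)).symm)
  have h2 : stdVec 1 = (0 : ℂ) := h1
  simp [stdVec] at h2

end OrientedCharts

/-! ### Minimal patches -/

/-- A smooth immersed plane patch `Y` with unit normal `N` and vanishing mean curvature. -/
structure IsMinimalPatch (U : Set ℂ) (Y N : ℂ → E3) : Prop where
  isOpen : IsOpen U
  smooth : ∀ w ∈ U, ContDiffAt ℝ ∞ Y w
  cross_ne : ∀ w ∈ U, cross (pd Y 0 w) (pd Y 1 w) ≠ 0
  normal : ∀ w ∈ U, N w = unitNormal (pd Y 0 w) (pd Y 1 w)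
  trace : ∀ w ∈ U,
    (inner ℝ (pd N 0 w) (pd Y 0 w) * inner ℝ (pd Y 1 w) (pd Y 1 w) -
      inner ℝ (pd N 0 w) (pd Y 1 w) * inner ℝ (pd Y 0 w) (pd Y 1 w) -
      inner ℝ (pd N 1 w) (pd Y 0 w) * inner ℝ (pd Y 0 w) (pd Y 1 w) +
      inner ℝ (pd N 1 w) (pd Y 1 w) * inner ℝ (pd Y 0 w) (pd Y 0 w) : ℝ) = 0

theorem contDiffAt_pd {Y : ℂ → E3} {w : ℂ} (h : ContDiffAt ℝ ∞ Y w) (i : Fin 2) :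
    ContDiffAt ℝ ∞ (pd Y i) w :=
  (h.fderiv_right (m := ∞) (by simp)).clm_apply contDiffAt_const

theorem contDiffAt_unitNormal {a b : ℂ → E3} {w : ℂ} (ha : ContDiffAt ℝ ∞ a w)
    (hb : ContDiffAt ℝ ∞ b w) (hc : cross (a w) (b w) ≠ 0) :
    ContDiffAt ℝ ∞ (fun v => unitNormal (a v) (b v)) w := by
  have h : ContDiffAt ℝ ∞ (fun v => crossL (a v) (b v)) w :=
    (contDiffAt_const.clm_apply ha).clm_apply hb
  exact ((h.norm ℝ hc).inv (norm_ne_zero_iff.mpr hc)).smul h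

/-! ### The fundamental forms and the shape operator in an oriented chart. -/

section Charts

variable {M : Type*} [TopologicalSpace M] [ChartedSpace ℂ M]
variable {X : M → E3} {z : OpenPartialHomeomorph M ℂ} {w : ℂ}

theorem IsOrientedChart.cross_pd (hz : IsOrientedChart z) (hX : IsMinimalImmersion X)
    (hw : w ∈ z.target) :
    cross (pd (fun v => X (z.symm v)) 0 w) (pd (fun v => X (z.symm v)) 1 w) ≠ 0 := by
  have hd := (hX.smooth (z.symm w)).mdifferentiableAt (by simp)
  rw [hz.pd_eq hw hd, hz.pd_eq hw hd, cross_lin_comb]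
  exact smul_ne_zero (hz.coord_det_pos hw).ne' (cross_diff_ne_zero hX _)

theorem IsOrientedChart.gaussMap_eq (hz : IsOrientedChart z) (hX : IsMinimalImmersion X)
    (hw : w ∈ z.target) :
    gaussMap X (z.symm w) =
      unitNormal (pd (fun v => X (z.symm v)) 0 w) (pd (fun v => X (z.symm v)) 1 w) := by
  have hd := (hX.smooth (z.symm w)).mdifferentiableAt (by simp)
  rw [hz.pd_eq hw hd, hz.pd_eq hw hd, unitNormal_lin_comb _ _ (hz.coord_det_pos hw)]
  rfl

theorem IsOrientedChart.contDiffAt_gaussMap (hz : IsOrientedChart z) (hX : IsMinimalImmersion X)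
    (hw : w ∈ z.target) : ContDiffAt ℝ ∞ (fun v => gaussMap X (z.symm v)) w := by
  have hY := hz.contDiffAt_comp_symm hX.smooth hw
  refine (contDiffAt_unitNormal (contDiffAt_pd hY 0) (contDiffAt_pd hY 1)
    (hz.cross_pd hX hw)).congr_of_eventuallyEq ?_
  filter_upwards [z.open_target.mem_nhds hw] with v hv
  exact hz.gaussMap_eq hX hv

theorem IsOrientedChart.mdifferentiableAt_gaussMap (hz : IsOrientedChart z)
    (hX : IsMinimalImmersion X) (hw : w ∈ z.target) :
    MDifferentiableAt 𝓘(ℝ, ℂ) 𝓘(ℝ, E3) (gaussMap X) (z.symm w) := by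
  have hs := z.map_target hw
  have h1 : MDifferentiableAt 𝓘(ℝ, ℂ) 𝓘(ℝ, ℂ) z (z.symm w) :=
    (contMDiffAt_of_mem_maximalAtlas hz.smooth hs).mdifferentiableAt (by simp)
  have h2 : MDifferentiableAt 𝓘(ℝ, ℂ) 𝓘(ℝ, E3) (fun v => gaussMap X (z.symm v))
      (z (z.symm w)) := by
    rw [z.right_inv hw]
    exact ((hz.contDiffAt_gaussMap hX hw).differentiableAt (by simp)).mdifferentiableAt
  refine (h2.comp _ h1).congr_of_eventuallyEq ?_
  filter_upwards [z.open_source.mem_nhds hs] with q hq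
  simp [z.left_inv hq]

theorem IsOrientedChart.inducedMetric_eq (hz : IsOrientedChart z) (hX : IsMinimalImmersion X)
    (hw : w ∈ z.target) (i j : Fin 2) :
    inducedMetric X (z.symm w) (coordVec z w i) (coordVec z w j) =
      inner ℝ (pd (fun v => X (z.symm v)) i w) (pd (fun v => X (z.symm v)) j w) := by
  have hd := (hX.smooth (z.symm w)).mdifferentiableAt (by simp)
  rw [inducedMetric, hz.diff_coordVec hw hd, hz.diff_coordVec hw hd]

theorem IsOrientedChart.secondForm_eq (hz : IsOrientedChart z) (hX : IsMinimalImmersion X)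
    (hw : w ∈ z.target) (i j : Fin 2) :
    secondForm X (z.symm w) (coordVec z w i) (coordVec z w j) =
      -inner ℝ (pd (fun v => gaussMap X (z.symm v)) i w) (pd (fun v => X (z.symm v)) j w) := by
  have hd := (hX.smooth (z.symm w)).mdifferentiableAt (by simp)
  rw [secondForm, hz.diff_coordVec hw hd,
    hz.diff_coordVec hw (hz.mdifferentiableAt_gaussMap hX hw)]

/-- The matrix of the first fundamental form in the coordinate basis. -/
def firstMatrix (X : M → E3) (z : OpenPartialHomeomorph M ℂ) (w : ℂ) : Matrix (Fin 2) (Fin 2) ℝ :=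
  Matrix.of fun i j => inducedMetric X (z.symm w) (coordVec z w i) (coordVec z w j)

/-- The matrix of the second fundamental form in the coordinate basis. -/
def secondMatrix (X : M → E3) (z : OpenPartialHomeomorph M ℂ) (w : ℂ) :
    Matrix (Fin 2) (Fin 2) ℝ :=
  Matrix.of fun i j => secondForm X (z.symm w) (coordVec z w i) (coordVec z w j)

/-- The change of basis matrix from the coordinate basis to the standard basis. -/
def jacobianMatrix (z : OpenPartialHomeomorph M ℂ) (w : ℂ) : Matrix (Fin 2) (Fin 2) ℝ :=
  !![Complex.re (coordVec z w 0), Complex.re (coordVec z w 1);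
    Complex.im (coordVec z w 0), Complex.im (coordVec z w 1)]

theorem IsOrientedChart.det_jacobianMatrix (hz : IsOrientedChart z) (hw : w ∈ z.target) :
    0 < (jacobianMatrix z w).det := by
  have h := hz.coord_det_pos hw
  rw [jacobianMatrix, Matrix.det_fin_two_of]
  linarith

theorem firstMatrix_eq (X : M → E3) (z : OpenPartialHomeomorph M ℂ) (w : ℂ) :
    firstMatrix X z w = (jacobianMatrix z w).transpose *
      (Matrix.of fun i j => inducedMetric X (z.symm w) (stdVec i) (stdVec j)) *
        jacobianMatrix z w := by
  ext i j
  simp only [firstMatrix, Matrix.of_apply, inducedMetric]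
  rw [diff_eq_re_im X _ (coordVec z w i), diff_eq_re_im X _ (coordVec z w j)]
  simp only [inner_add_left, inner_add_right, inner_smul_left, inner_smul_right,
    RCLike.conj_to_real, Matrix.mul_apply, Fin.sum_univ_two, jacobianMatrix,
    Matrix.transpose_apply, Matrix.of_apply]
  fin_cases i <;> fin_cases j <;> simp <;> ring

theorem secondMatrix_eq (X : M → E3) (z : OpenPartialHomeomorph M ℂ) (w : ℂ) :
    secondMatrix X z w = (jacobianMatrix z w).transpose *
      (Matrix.of fun i j => secondForm X (z.symm w) (stdVec i) (stdVec j)) *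
        jacobianMatrix z w := by
  ext i j
  simp only [secondMatrix, Matrix.of_apply, secondForm]
  rw [diff_eq_re_im X _ (coordVec z w j), diff_eq_re_im (gaussMap X) _ (coordVec z w i)]
  simp only [inner_add_left, inner_add_right, inner_smul_left, inner_smul_right,
    RCLike.conj_to_real, Matrix.mul_apply, Fin.sum_univ_two, jacobianMatrix,
    Matrix.transpose_apply, Matrix.of_apply]
  fin_cases i <;> fin_cases j <;> simp <;> ring

/-- Both fundamental forms transform as `JᵀBJ`, so the shape operator is conjugated by `J`. Trace,
determinant and being scalar are therefore readable in any oriented chart. -/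
theorem IsOrientedChart.shapeOperator_conj (hz : IsOrientedChart z) (hw : w ∈ z.target) :
    (firstMatrix X z w)⁻¹ * secondMatrix X z w =
      (jacobianMatrix z w)⁻¹ * shapeOperator X (z.symm w) * jacobianMatrix z w := by
  have hJ : IsUnit (jacobianMatrix z w).transpose.det := by
    rw [Matrix.det_transpose]; exact (hz.det_jacobianMatrix hw).ne'.isUnit
  rw [firstMatrix_eq, secondMatrix_eq, shapeOperator, Matrix.mul_inv_rev, Matrix.mul_inv_rev]
  simp only [Matrix.mul_assoc]
  rw [Matrix.nonsing_inv_mul_cancel_left _ _ hJ]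

theorem IsOrientedChart.trace_shapeOperator (hz : IsOrientedChart z) (hw : w ∈ z.target) :
    (shapeOperator X (z.symm w)).trace = ((firstMatrix X z w)⁻¹ * secondMatrix X z w).trace := by
  rw [hz.shapeOperator_conj hw, Matrix.trace_mul_comm, ← Matrix.mul_assoc,
    Matrix.mul_nonsing_inv _ (hz.det_jacobianMatrix hw).ne'.isUnit, Matrix.one_mul]

theorem IsOrientedChart.gaussCurvature_eq (hz : IsOrientedChart z) (hw : w ∈ z.target) :
    gaussCurvature X (z.symm w) = ((firstMatrix X z w)⁻¹ * secondMatrix X z w).det := by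
  have hJ := (hz.det_jacobianMatrix hw).ne'
  rw [hz.shapeOperator_conj hw, Matrix.det_mul, Matrix.det_mul, Matrix.det_nonsing_inv,
    Ring.inverse_eq_inv', gaussCurvature]
  field_simp

theorem IsOrientedChart.isUmbilic_iff (hz : IsOrientedChart z) (hw : w ∈ z.target) :
    IsUmbilic X (z.symm w) ↔ ∃ κ : ℝ, (firstMatrix X z w)⁻¹ * secondMatrix X z w =
      κ • (1 : Matrix (Fin 2) (Fin 2) ℝ) := by
  have hJ : IsUnit (jacobianMatrix z w).det := (hz.det_jacobianMatrix hw).ne'.isUnit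
  rw [hz.shapeOperator_conj hw]
  refine exists_congr fun κ => ⟨fun h => ?_, fun h => ?_⟩
  · rw [h, Matrix.mul_smul, Matrix.mul_one, Matrix.smul_mul, Matrix.nonsing_inv_mul _ hJ]
  · have h2 := congrArg (fun A => jacobianMatrix z w * A * (jacobianMatrix z w)⁻¹) h
    simp only [Matrix.mul_smul, Matrix.smul_mul, Matrix.mul_one,
      Matrix.mul_nonsing_inv _ hJ, Matrix.mul_assoc,
      Matrix.mul_nonsing_inv_cancel_left _ _ hJ] at h2
    exact h2

theorem IsOrientedChart.isMinimalPatch (hz : IsOrientedChart z) (hX : IsMinimalImmersion X) :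
    IsMinimalPatch z.target (fun v => X (z.symm v)) (fun v => gaussMap X (z.symm v)) where
  isOpen := z.open_target
  smooth _ hw := hz.contDiffAt_comp_symm hX.smooth hw
  cross_ne _ hw := hz.cross_pd hX hw
  normal _ hw := hz.gaussMap_eq hX hw
  trace w hw := by
    have h := hX.minimal (z.symm w)
    rw [meanCurvature, hz.trace_shapeOperator hw, div_eq_zero_iff, or_iff_left two_ne_zero] at h
    have hdet : (firstMatrix X z w).det ≠ 0 := by
      have := inner_cross_self (pd (fun v => X (z.symm v)) 0 w) (pd (fun v => X (z.symm v)) 1 w)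
      have h0 := hz.cross_pd hX hw
      rw [Matrix.det_fin_two]
      simp only [firstMatrix, Matrix.of_apply, hz.inducedMetric_eq hX hw]
      rw [real_inner_comm (pd (fun v => X (z.symm v)) 0 w) (pd (fun v => X (z.symm v)) 1 w), ← sq,
        ← this]
      simpa using h0
    -- Writing the inverse through the adjugate clears the nonzero determinant of the first
    -- fundamental form and leaves a polynomial condition.
    rw [Matrix.inv_def, Matrix.smul_mul, Matrix.trace_smul, Ring.inverse_eq_inv', smul_eq_mul,
      mul_eq_zero, or_iff_right (inv_ne_zero hdet), Matrix.adjugate_fin_two,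
      Matrix.trace_fin_two] at h
    simp only [firstMatrix, secondMatrix, Matrix.mul_apply, Fin.sum_univ_two, Matrix.of_apply,
      hz.inducedMetric_eq hX hw, hz.secondForm_eq hX hw, Matrix.cons_val', Matrix.cons_val_zero,
      Matrix.cons_val_one, Matrix.cons_val_fin_one] at h
    rw [real_inner_comm (pd (fun v => X (z.symm v)) 1 w) (pd (fun v => X (z.symm v)) 0 w)]
    rw [real_inner_comm (pd (fun v => X (z.symm v)) 1 w) (pd (fun v => X (z.symm v)) 0 w)] at h
    linarith

end Charts

/-! ### Closedness of `N × dY` on a minimal patch. -/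

section Patch

variable {U : Set ℂ} {Y N : ℂ → E3} {w : ℂ}

theorem IsMinimalPatch.contDiffAt_normal (h : IsMinimalPatch U Y N) (hw : w ∈ U) :
    ContDiffAt ℝ ∞ N w := by
  refine (contDiffAt_unitNormal (contDiffAt_pd (h.smooth w hw) 0) (contDiffAt_pd (h.smooth w hw) 1)
    (h.cross_ne w hw)).congr_of_eventuallyEq ?_
  filter_upwards [h.isOpen.mem_nhds hw] with v hv
  exact h.normal v hv

theorem inner_pd_add_inner_pd {a b : ℂ → E3} {c : ℝ} (ha : DifferentiableAt ℝ a w)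
    (hb : DifferentiableAt ℝ b w) (hab : ∀ᶠ v in nhds w, inner ℝ (a v) (b v) = c) (i : Fin 2) :
    (inner ℝ (a w) (pd b i w) + inner ℝ (pd a i w) (b w) : ℝ) = 0 := by
  have h := Filter.EventuallyEq.fderiv_eq (𝕜 := ℝ) (f := fun _ => c) hab
  have h2 := congrArg (fun L : ℂ →L[ℝ] ℝ => L (stdVec i)) h
  simp only [fderiv_inner_apply ℝ ha hb, fderiv_fun_const, Pi.zero_apply] at h2
  exact h2

theorem IsMinimalPatch.inner_normal_pd (h : IsMinimalPatch U Y N) (hw : w ∈ U) (j : Fin 2) :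
    inner ℝ (N w) (pd Y j w) = (0 : ℝ) := by
  rw [h.normal w hw]
  fin_cases j
  · exact inner_unitNormal_left _ _
  · exact inner_unitNormal_right _ _

theorem IsMinimalPatch.inner_normal_self (h : IsMinimalPatch U Y N) (hw : w ∈ U) :
    inner ℝ (N w) (N w) = (1 : ℝ) := by
  rw [h.normal w hw, inner_unitNormal_self (h.cross_ne w hw)]

theorem IsMinimalPatch.inner_pd_normal (h : IsMinimalPatch U Y N) (hw : w ∈ U) (i : Fin 2) :
    inner ℝ (pd N i w) (N w) = (0 : ℝ) := by
  have hN := (h.contDiffAt_normal hw).differentiableAt (by simp)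
  have := inner_pd_add_inner_pd (c := 1) hN hN
    (by filter_upwards [h.isOpen.mem_nhds hw] with v hv using h.inner_normal_self hv) i
  rw [real_inner_comm] at this
  linarith

/-- `A(∂ᵢ, ∂ⱼ) = N · ∂ᵢ∂ⱼY`. -/
theorem IsMinimalPatch.inner_pd_normal_pd (h : IsMinimalPatch U Y N) (hw : w ∈ U) (i j : Fin 2) :
    -inner ℝ (pd N i w) (pd Y j w) = (inner ℝ (N w) (pd (pd Y j) i w) : ℝ) := by
  have hN := (h.contDiffAt_normal hw).differentiableAt (by simp)
  have hY := (contDiffAt_pd (h.smooth w hw) j).differentiableAt (by simp)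
  have := inner_pd_add_inner_pd (c := 0) hN hY
    (by filter_upwards [h.isOpen.mem_nhds hw] with v hv using h.inner_normal_pd hv j) i
  linarith

theorem pd_comm {Y : ℂ → E3} (h : ContDiffAt ℝ ∞ Y w) (i j : Fin 2) :
    pd (pd Y i) j w = pd (pd Y j) i w := by
  have hd : DifferentiableAt ℝ (fderiv ℝ Y) w :=
    (h.fderiv_right (m := ∞) (by simp)).differentiableAt (by simp)
  have key (i j : Fin 2) : pd (pd Y i) j w = fderiv ℝ (fderiv ℝ Y) w (stdVec j) (stdVec i) := by
    change fderiv ℝ (fun v => fderiv ℝ Y v (stdVec i)) w (stdVec j) = _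
    rw [fderiv_clm_apply hd (differentiableAt_const _)]
    simp
  rw [key, key]
  exact (h.isSymmSndFDerivAt (by
    simpa using WithTop.coe_le_coe.mpr (le_top (a := (2 : ℕ∞))))) _ _

/-- The derivatives of `N` are tangent, so both sides are normal to the surface, and the normal
component of their difference is a multiple of the mean curvature. Minimality enters the closedness
of `N × dY` here. -/
theorem IsMinimalPatch.cross_pd_comm (h : IsMinimalPatch U Y N) (hw : w ∈ U) :
    cross (pd N 0 w) (pd Y 1 w) = cross (pd N 1 w) (pd Y 0 w) := by
  have hi (i : Fin 2) : inner ℝ (pd N i w) (cross (pd Y 0 w) (pd Y 1 w)) = (0 : ℝ) := by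
    rw [cross_eq_norm_smul_unitNormal (h.cross_ne w hw), inner_smul_right, ← h.normal w hw,
      h.inner_pd_normal hw, mul_zero]
  exact cross_eq_cross_of_trace (h.cross_ne w hw) (hi 0) (hi 1) (h.trace w hw)

theorem pd_cross {a b : ℂ → E3} (ha : DifferentiableAt ℝ a w) (hb : DifferentiableAt ℝ b w)
    (i : Fin 2) :
    pd (fun v => cross (a v) (b v)) i w = cross (a w) (pd b i w) + cross (pd a i w) (b w) := by
  have h := crossL.hasFDerivAt_of_bilinear ha.hasFDerivAt hb.hasFDerivAt
  change fderiv ℝ (fun v => crossL (a v) (b v)) w (stdVec i) = _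
  rw [h.fderiv]
  rfl

/-- The `E3`-valued one-form `N × dY` is closed. -/
theorem IsMinimalPatch.pd_cross_comm (h : IsMinimalPatch U Y N) (hw : w ∈ U) :
    pd (fun v => cross (N v) (pd Y 1 v)) 0 w = pd (fun v => cross (N v) (pd Y 0 v)) 1 w := by
  have hN := (h.contDiffAt_normal hw).differentiableAt (by simp)
  have hY (j : Fin 2) := (contDiffAt_pd (h.smooth w hw) j).differentiableAt (by simp)
  rw [pd_cross hN (hY 1), pd_cross hN (hY 0), h.cross_pd_comm hw, pd_comm (h.smooth w hw) 1 0]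

end Patch

/-! ### Isothermal coordinates -/

/-- The hypotheses say that the parameters of the patch are `Y_k` and its conjugate. With `c = a ×
b`, the expansions of `(c × a)_k` and `(c × b)_k` give `a·b = 0` and `|b|² = |c|`; Lagrange's
identity then gives `|a|² = |c|`. -/
theorem conformal_of_conj_coord {a b : E3} (hc : cross a b ≠ 0) {k : Fin 3} (ha : a k = 1)
    (hb : b k = 0) (hna : cross (unitNormal a b) a k = 0)
    (hnb : cross (unitNormal a b) b k = -1) :
    inner ℝ a a = (inner ℝ b b : ℝ) ∧ inner ℝ a b = (0 : ℝ) := by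
  have hpos : 0 < ‖cross a b‖ := norm_pos_iff.mpr hc
  have h (v : E3) : ‖cross a b‖ * cross (unitNormal a b) v k = cross (cross a b) v k := by
    rw [unitNormal, ← crossL_apply (_ • _), map_smul]
    simp [hpos.ne']
  have h1 : cross (cross a b) a k = b k * inner ℝ a a - a k * inner ℝ a b := by
    fin_cases k <;> simp only [inner_eq_coord, Fin.zero_eta, Fin.mk_one, Fin.reduceFinMk,
      cross_coord_zero, cross_coord_one, cross_coord_two] <;> ring
  have h2 : cross (cross a b) b k = b k * inner ℝ a b - a k * inner ℝ b b := by
    fin_cases k <;> simp only [inner_eq_coord, Fin.zero_eta, Fin.mk_one, Fin.reduceFinMk,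
      cross_coord_zero, cross_coord_one, cross_coord_two] <;> ring
  rw [← h, hna, ha, hb] at h1
  rw [← h, hnb, ha, hb] at h2
  have h3 := inner_cross_self a b
  rw [real_inner_self_eq_norm_sq (cross a b)] at h3
  have hab : (inner ℝ a b : ℝ) = 0 := by linarith
  refine ⟨?_, hab⟩
  rw [hab] at h2 h3
  have hbb : (inner ℝ b b : ℝ) = ‖cross a b‖ := by linarith
  rw [hbb] at h3 ⊢
  have : ‖cross a b‖ * (inner ℝ a a - ‖cross a b‖) = 0 := by linarith
  rcases mul_eq_zero.mp this with h | h <;> linarith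

section Isothermal

variable {U : Set ℂ} {Y N : ℂ → E3} {w : ℂ}

/-- The differential `-(N × dY)_k` of the harmonic conjugate of the coordinate function `Y_k`. -/
def conjForm (Y N : ℂ → E3) (k : Fin 3) (w : ℂ) : ℂ →L[ℝ] ℝ :=
  -((EuclideanSpace.proj k : E3 →L[ℝ] ℝ).comp ((crossL (N w)).comp (fderiv ℝ Y w)))

theorem IsMinimalPatch.contDiffAt_conjForm (h : IsMinimalPatch U Y N) (hw : w ∈ U) (k : Fin 3) :
    ContDiffAt ℝ ∞ (conjForm Y N k) w := by
  have h1 : ContDiffAt ℝ ∞ (fun v => crossL (N v)) w :=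
    contDiffAt_const.clm_apply (h.contDiffAt_normal hw)
  have h2 : ContDiffAt ℝ ∞ (fderiv ℝ Y) w := (h.smooth w hw).fderiv_right (m := ∞) (by simp)
  exact (contDiffAt_const.clm_comp (h1.clm_comp h2)).neg

theorem fderiv_conjForm_apply (hd : DifferentiableAt ℝ (conjForm Y N k) w) 
    (hc : ∀ j, DifferentiableAt ℝ (fun v => cross (N v) (pd Y j v)) w) (i j : Fin 2) :
    fderiv ℝ (conjForm Y N k) w (stdVec i) (stdVec j) =
      -pd (fun v => cross (N v) (pd Y j v)) i w k := by
  have h1 : fderiv ℝ (fun v => conjForm Y N k v (stdVec j)) w (stdVec i) =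
      fderiv ℝ (conjForm Y N k) w (stdVec i) (stdVec j) := by
    rw [fderiv_clm_apply hd (differentiableAt_const _)]
    simp
  rw [← h1]
  have h2 : (fun v => conjForm Y N k v (stdVec j)) =
      ⇑(-(EuclideanSpace.proj k : E3 →L[ℝ] ℝ)) ∘ fun v => cross (N v) (pd Y j v) := rfl
  rw [h2, ((-(EuclideanSpace.proj k : E3 →L[ℝ] ℝ)).hasFDerivAt.comp w (hc j).hasFDerivAt).fderiv]
  rfl

/-- Symmetry of the derivative is closedness of the one-form, as the Poincaré lemma needs it. By
bilinearity only the pair `1, i` matters, where it is `pd_cross_comm`. -/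
theorem IsMinimalPatch.fderiv_conjForm_comm (h : IsMinimalPatch U Y N) (hw : w ∈ U) (k : Fin 3)
    (x y : ℂ) : fderiv ℝ (conjForm Y N k) w x y = fderiv ℝ (conjForm Y N k) w y x := by
  have hd := (h.contDiffAt_conjForm hw k).differentiableAt (by simp)
  have hc (j : Fin 2) : DifferentiableAt ℝ (fun v => cross (N v) (pd Y j v)) w := by
    have h1 : ContDiffAt ℝ ∞ (fun v => crossL (N v) (pd Y j v)) w :=
      (contDiffAt_const.clm_apply (h.contDiffAt_normal hw)).clm_apply
        (contDiffAt_pd (h.smooth w hw) j)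
    exact h1.differentiableAt (by simp)
  have key : fderiv ℝ (conjForm Y N k) w 1 Complex.I = fderiv ℝ (conjForm Y N k) w Complex.I 1 := by
    have h01 := fderiv_conjForm_apply hd hc 0 1
    have h10 := fderiv_conjForm_apply hd hc 1 0
    rw [h.pd_cross_comm hw, ← h10] at h01
    exact h01
  rw [apply_eq_re_im (fderiv ℝ (conjForm Y N k) w) x,
    apply_eq_re_im (fderiv ℝ (conjForm Y N k) w) y]
  simp only [add_apply, smul_apply]
  rw [apply_eq_re_im (fderiv ℝ (conjForm Y N k) w 1) x,
    apply_eq_re_im (fderiv ℝ (conjForm Y N k) w 1) y,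
    apply_eq_re_im (fderiv ℝ (conjForm Y N k) w Complex.I) x,
    apply_eq_re_im (fderiv ℝ (conjForm Y N k) w Complex.I) y, key]
  simp only [smul_eq_mul]
  ring

/-- A coordinate function of a minimal patch together with its harmonic conjugate is a local
diffeomorphism wherever the normal is not parallel to the coordinate axis. -/
theorem IsMinimalPatch.exists_conj_coord (h : IsMinimalPatch U Y N) (hw : w ∈ U) :
    ∃ (φ : OpenPartialHomeomorph ℂ ℂ) (k : Fin 3), w ∈ φ.source ∧ φ.source ⊆ U ∧
      ∀ v ∈ φ.source, ContDiffAt ℝ ∞ φ v ∧ 0 < (fderiv ℝ φ v).det ∧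
        ∀ x, fderiv ℝ φ v x =
          ((fderiv ℝ Y v x k : ℝ) : ℂ) +
            ((-cross (N v) (fderiv ℝ Y v x) k : ℝ) : ℂ) * Complex.I := by
  obtain ⟨k, hk⟩ := exists_cross_coord_sq_lt (h.cross_ne w hw)
  have hcont (v : ℂ) (hv : v ∈ U) : ContinuousAt (fun v => cross (pd Y 0 v) (pd Y 1 v)) v := by
    have h1 : ContDiffAt ℝ ∞ (fun v => crossL (pd Y 0 v) (pd Y 1 v)) v :=
      (contDiffAt_const.clm_apply (contDiffAt_pd (h.smooth v hv) 0)).clm_apply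
        (contDiffAt_pd (h.smooth v hv) 1)
    exact h1.continuousAt
  have hk' : ∀ᶠ v in nhds w, cross (pd Y 0 v) (pd Y 1 v) k ^ 2 <
      inner ℝ (cross (pd Y 0 v) (pd Y 1 v)) (cross (pd Y 0 v) (pd Y 1 v)) := by
    have hc := hcont w hw
    refine ContinuousAt.eventually_lt ?_ (hc.inner hc) hk
    exact ((EuclideanSpace.proj k : E3 →L[ℝ] ℝ).continuous.continuousAt.comp hc).pow 2
  obtain ⟨r, hr, hball⟩ := Metric.eventually_nhds_iff_ball.mp
    (hk'.and (h.isOpen.mem_nhds hw))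
  have hBU : Metric.ball w r ⊆ U := fun v hv => (hball v hv).2
  -- The Poincaré lemma on a ball provides the harmonic conjugate `f` of `Y_k`.
  obtain ⟨f, hf⟩ := (convex_ball w r).exists_forall_hasFDerivAt_of_fderiv_symmetric
    Metric.isOpen_ball
    (fun v hv => ((h.contDiffAt_conjForm (hBU hv) k).differentiableAt
      (by simp)).differentiableWithinAt)
    (fun v hv x y => h.fderiv_conjForm_comm (hBU hv) k x y)
  have hfs : ContDiffOn ℝ ∞ f (Metric.ball w r) := by
    rw [contDiffOn_infty_iff_fderiv_of_isOpen Metric.isOpen_ball]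
    refine ⟨fun v hv => (hf v hv).differentiableAt.differentiableWithinAt, ?_⟩
    intro v hv
    refine ((h.contDiffAt_conjForm (hBU hv) k).contDiffWithinAt).congr (fun u hu => ?_) ?_
    · exact (hf u hu).fderiv
    · exact (hf v hv).fderiv
  set F : ℂ → ℂ := fun v => ((Y v k : ℝ) : ℂ) + ((f v : ℝ) : ℂ) * Complex.I with hF
  have hFs (v : ℂ) (hv : v ∈ Metric.ball w r) : ContDiffAt ℝ ∞ F v := by
    have h1 : ContDiffAt ℝ ∞ (fun v => Y v k) v :=
      (EuclideanSpace.proj k : E3 →L[ℝ] ℝ).contDiff.contDiffAt.comp v (h.smooth v (hBU hv))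
    have h2 : ContDiffAt ℝ ∞ f v := hfs.contDiffAt (Metric.isOpen_ball.mem_nhds hv)
    exact (Complex.ofRealCLM.contDiff.contDiffAt.comp v h1).add
      ((Complex.ofRealCLM.contDiff.contDiffAt.comp v h2).mul contDiffAt_const)
  have hFd (v : ℂ) (hv : v ∈ Metric.ball w r) (x : ℂ) : fderiv ℝ F v x =
      ((fderiv ℝ Y v x k : ℝ) : ℂ) + ((-cross (N v) (fderiv ℝ Y v x) k : ℝ) : ℂ) * Complex.I := by
    have h0 := ((h.smooth v (hBU hv)).differentiableAt (by simp)).hasFDerivAt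
    have h1 := Complex.ofRealCLM.hasFDerivAt.comp v
      ((EuclideanSpace.proj k : E3 →L[ℝ] ℝ).hasFDerivAt.comp v h0)
    have h2 := (Complex.ofRealCLM.hasFDerivAt.comp v (hf v hv)).mul_const' Complex.I
    have h3 : HasFDerivAt F _ v := h1.add h2
    rw [h3.fderiv]
    rfl
  have hdet (v : ℂ) (hv : v ∈ Metric.ball w r) : 0 < (fderiv ℝ F v).det := by
    have hne := h.cross_ne v (hBU hv)
    have hpos : 0 < ‖cross (pd Y 0 v) (pd Y 1 v)‖ := norm_pos_iff.mpr hne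
    have hj := conj_jacobian (pd Y 0 v) (pd Y 1 v) k
    have hlt := (hball v hv).1
    rw [← h.normal v (hBU hv)] at hj
    rw [det_eq_coord, hFd v hv, hFd v hv]
    have e0 : fderiv ℝ Y v 1 = pd Y 0 v := rfl
    have e1 : fderiv ℝ Y v Complex.I = pd Y 1 v := rfl
    rw [e0, e1]
    simp only [Complex.add_re, Complex.add_im, Complex.ofReal_re, Complex.ofReal_im,
      Complex.re_ofReal_mul, Complex.im_ofReal_mul, Complex.I_re, Complex.I_im]
    refine (mul_pos_iff_of_pos_left hpos).mp ?_
    linarith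
  have hw0 : w ∈ Metric.ball w r := Metric.mem_ball_self hr
  have hFw : HasFDerivAt F (((fderiv ℝ F w).toContinuousLinearEquivOfDetNeZero
      (hdet w hw0).ne' : ℂ ≃L[ℝ] ℂ) : ℂ →L[ℝ] ℂ) w :=
    ((hFs w hw0).differentiableAt (by simp)).hasFDerivAt
  have hcoe := (hFs w hw0).toOpenPartialHomeomorph_coe hFw (by simp)
  -- The inverse function theorem gives a local inverse at `w`; restricting to the ball keeps
  -- smoothness, the sign of the Jacobian and the formula for `dF` on the whole source.
  refine ⟨((hFs w hw0).toOpenPartialHomeomorph F hFw (by simp)).restrOpen (Metric.ball w r)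
    Metric.isOpen_ball, k, ⟨(hFs w hw0).mem_toOpenPartialHomeomorph_source hFw (by simp), hw0⟩,
    fun v hv => hBU hv.2, fun v hv => ?_⟩
  have hv' : v ∈ Metric.ball w r := hv.2
  exact ⟨hFs v hv', hdet v hv', hFd v hv'⟩

end Isothermal

/-! ### Existence of isothermal charts around every point. -/

section ExistsCoord

variable {M : Type*} [TopologicalSpace M] [ChartedSpace ℂ M] [IsManifold 𝓘(ℝ, ℂ) ∞ M]
variable {X : M → E3} {z : OpenPartialHomeomorph M ℂ}

/-- `fderiv` is zero where the function is not differentiable, and the zero map has determinant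
zero. -/
theorem differentiableAt_of_det_pos {f : ℂ → ℂ} {w : ℂ} (h : 0 < (fderiv ℝ f w).det) :
    DifferentiableAt ℝ f w := by
  by_contra hd
  rw [fderiv_zero_of_not_differentiableAt hd, det_eq_coord] at h
  simp at h

theorem contDiffAt_symm_of_det_pos {φ : OpenPartialHomeomorph ℂ ℂ} {w : ℂ} (hw : w ∈ φ.target)
    (hs : ContDiffAt ℝ ∞ φ (φ.symm w)) (hd : 0 < (fderiv ℝ φ (φ.symm w)).det) :
    ContDiffAt ℝ ∞ φ.symm w := by
  have hf : HasFDerivAt φ (((fderiv ℝ φ (φ.symm w)).toContinuousLinearEquivOfDetNeZero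
      hd.ne' : ℂ ≃L[ℝ] ℂ) : ℂ →L[ℝ] ℂ) (φ.symm w) :=
    (hs.differentiableAt (by simp)).hasFDerivAt
  exact φ.contDiffAt_symm hw hf hs

theorem fderiv_apply_fderiv_symm {φ : OpenPartialHomeomorph ℂ ℂ} {w : ℂ} (hw : w ∈ φ.target)
    (hs : ContDiffAt ℝ ∞ φ (φ.symm w)) (hd : 0 < (fderiv ℝ φ (φ.symm w)).det) :
    (fderiv ℝ φ (φ.symm w)).comp (fderiv ℝ φ.symm w) = ContinuousLinearMap.id ℝ ℂ := by
  rw [← fderiv_comp _ (hs.differentiableAt (by simp))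
    ((contDiffAt_symm_of_det_pos hw hs hd).differentiableAt (by simp))]
  have : φ ∘ φ.symm =ᶠ[nhds w] id := by
    filter_upwards [φ.open_target.mem_nhds hw] with v hv using φ.right_inv hv
  rw [this.fderiv_eq, fderiv_id]

theorem det_comp (A B : ℂ →L[ℝ] ℂ) : (A.comp B).det = A.det * B.det :=
  LinearMap.det_comp _ _

/-- Composing an oriented chart with an orientation preserving local diffeomorphism of the plane
gives an oriented chart. -/
theorem IsOrientedChart.trans (hz : IsOrientedChart z) {φ : OpenPartialHomeomorph ℂ ℂ}
    (hs : ∀ v ∈ φ.source, ContDiffAt ℝ ∞ φ v) (hd : ∀ v ∈ φ.source, 0 < (fderiv ℝ φ v).det) :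
    IsOrientedChart (z.trans φ) where
  smooth := by
    apply OpenPartialHomeomorph.mem_maximalAtlas_of_contMDiffOn
    · intro q hq
      have hq' : q ∈ z.source ∧ z q ∈ φ.source := by simpa using hq
      exact ((hs _ hq'.2).contMDiffAt.comp q
        (contMDiffAt_of_mem_maximalAtlas hz.smooth hq'.1)).contMDiffWithinAt
    · intro w hw
      have hw' : w ∈ φ.target ∧ φ.symm w ∈ z.target := by simpa using hw
      have hsrc := φ.map_target hw'.1
      exact ((contMDiffAt_symm_of_mem_maximalAtlas hz.smooth hw'.2).comp w
        (contDiffAt_symm_of_det_pos hw'.1 (hs _ hsrc) (hd _ hsrc)).contMDiffAt).contMDiffWithinAt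
  oriented := by
    intro e he w hw
    have hw' : (w ∈ φ.target ∧ φ.symm w ∈ z.target) ∧ z.symm (φ.symm w) ∈ e.source := by
      simpa using hw
    have hsrc := φ.map_target hw'.1.1
    have hpos := hz.oriented e he (φ.symm w) (by simpa using ⟨hw'.1.2, hw'.2⟩)
    have hcomp := congrArg ContinuousLinearMap.det
      (fderiv_apply_fderiv_symm hw'.1.1 (hs _ hsrc) (hd _ hsrc))
    rw [det_comp] at hcomp
    have hid : (ContinuousLinearMap.id ℝ ℂ).det = 1 := by rw [det_eq_coord]; simp
    have hpos' : 0 < (fderiv ℝ φ.symm w).det := by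
      refine (mul_pos_iff_of_pos_left (hd _ hsrc)).mp ?_
      rw [hcomp, hid]
      exact one_pos
    have hfun : ⇑((z.trans φ).symm ≫ₕ e) = ⇑(z.symm ≫ₕ e) ∘ φ.symm := rfl
    rw [hfun, fderiv_comp _ (differentiableAt_of_det_pos hpos) (differentiableAt_of_det_pos hpos'),
      det_comp]
    exact mul_pos hpos hpos'

/-- Existence of isothermal coordinates on minimal surfaces. -/
theorem exists_isHolomorphicCoord [OrientedAtlas M] (hX : IsMinimalImmersion X) (p : M) :
    ∃ z : OpenPartialHomeomorph M ℂ, IsHolomorphicCoord X z ∧ p ∈ z.source := by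
  have hz := isOrientedChart_chartAt (M := M) p
  set z := chartAt ℂ p
  have hp : p ∈ z.source := mem_chart_source ℂ p
  have hP := hz.isMinimalPatch hX
  obtain ⟨φ, k, hwφ, -, hφ⟩ := hP.exists_conj_coord (z.map_source hp)
  have ht := hz.trans (fun v hv => (hφ v hv).1) (fun v hv => (hφ v hv).2.1)
  refine ⟨z.trans φ, ⟨ht.smooth, ht.oriented, fun w hw => ?_⟩, by simpa using ⟨hp, hwφ⟩⟩
  rw [ht.inducedMetric_eq hX hw, ht.inducedMetric_eq hX hw, ht.inducedMetric_eq hX hw]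
  have hw' : w ∈ φ.target ∧ φ.symm w ∈ z.target := by simpa using hw
  have hsrc := φ.map_target hw'.1
  obtain ⟨hs, hd, hF⟩ := hφ _ hsrc
  have hcomp := fderiv_apply_fderiv_symm hw'.1 hs hd
  have hY := (hP.smooth _ hw'.2).differentiableAt (by simp)
  have hsym := (contDiffAt_symm_of_det_pos hw'.1 hs hd).differentiableAt (by simp)
  have hpd (i : Fin 2) : pd (fun v => X ((z.trans φ).symm v)) i w =
      fderiv ℝ (fun v => X (z.symm v)) (φ.symm w) (fderiv ℝ φ.symm w (stdVec i)) := by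
    rw [pd, show (fun v => X ((z.trans φ).symm v)) = (fun v => X (z.symm v)) ∘ φ.symm from rfl,
      fderiv_comp _ hY hsym]
    rfl
  -- This is `dφ ∘ d(φ⁻¹) = id` with the explicit formula for `dφ`. Its real and imaginary parts are
  -- the hypotheses of `conformal_of_conj_coord`.
  have hcoord (i : Fin 2) : stdVec i =
      ((pd (fun v => X ((z.trans φ).symm v)) i w k : ℝ) : ℂ) +
      ((-cross (gaussMap X (z.symm (φ.symm w))) (pd (fun v => X ((z.trans φ).symm v)) i w) k : ℝ) :
        ℂ) * Complex.I := by
    rw [hpd, ← hF, ← ContinuousLinearMap.comp_apply, hcomp]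
    rfl
  have hN : gaussMap X (z.symm (φ.symm w)) = _ := ht.gaussMap_eq hX hw
  rw [hN] at hcoord
  have h0 := hcoord 0
  have h1 := hcoord 1
  have hre0 := congrArg Complex.re h0
  have him0 := congrArg Complex.im h0
  have hre1 := congrArg Complex.re h1
  have him1 := congrArg Complex.im h1
  simp [stdVec] at hre0 him0 hre1 him1
  exact conformal_of_conj_coord (ht.cross_pd hX hw) hre0.symm hre1.symm him0
    (neg_eq_iff_eq_neg.mp him1.symm)

end ExistsCoord

/-! ### Conformal minimal patches and the Weierstrass data -/

/-- A minimal patch in isothermal coordinates. -/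
structure IsConformalPatch (U : Set ℂ) (Y N : ℂ → E3) : Prop extends IsMinimalPatch U Y N where
  inner_self : ∀ w ∈ U, inner ℝ (pd Y 0 w) (pd Y 0 w) = (inner ℝ (pd Y 1 w) (pd Y 1 w) : ℝ)
  inner_cross : ∀ w ∈ U, inner ℝ (pd Y 0 w) (pd Y 1 w) = (0 : ℝ)

theorem IsHolomorphicCoord.isConformalPatch {M : Type*} [TopologicalSpace M] [ChartedSpace ℂ M]
    [IsManifold 𝓘(ℝ, ℂ) ∞ M] {X : M → E3} {z : OpenPartialHomeomorph M ℂ}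
    (hz : IsHolomorphicCoord X z) (hX : IsMinimalImmersion X) :
    IsConformalPatch z.target (fun v => X (z.symm v)) (fun v => gaussMap X (z.symm v)) where
  toIsMinimalPatch := hz.isOrientedChart.isMinimalPatch hX
  inner_self w hw := by
    have h := (hz.conformal w hw).1
    rwa [hz.isOrientedChart.inducedMetric_eq hX hw, hz.isOrientedChart.inducedMetric_eq hX hw] at h
  inner_cross w hw := by
    have h := (hz.conformal w hw).2
    rwa [hz.isOrientedChart.inducedMetric_eq hX hw] at h

section Conformal

variable {U : Set ℂ} {Y N : ℂ → E3} {w : ℂ}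

/-- For a conformal frame `N × dY` has components `∂_y Y` and `-∂_x Y`, so its closedness is
Laplace's equation for `Y`. -/
theorem IsConformalPatch.laplace (h : IsConformalPatch U Y N) (hw : w ∈ U) :
    pd (pd Y 1) 1 w = -pd (pd Y 0) 0 w := by
  have h1 := h.pd_cross_comm hw
  have e0 : (fun v => cross (N v) (pd Y 0 v)) =ᶠ[nhds w] pd Y 1 := by
    filter_upwards [h.isOpen.mem_nhds hw] with v hv
    rw [h.normal v hv, cross_unitNormal_left (h.cross_ne v hv) (h.inner_self v hv)
      (h.inner_cross v hv)]
  have e1 : (fun v => cross (N v) (pd Y 1 v)) =ᶠ[nhds w] fun v => -pd Y 0 v := by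
    filter_upwards [h.isOpen.mem_nhds hw] with v hv
    rw [h.normal v hv, cross_unitNormal_right (h.cross_ne v hv) (h.inner_self v hv)
      (h.inner_cross v hv)]
  rw [pd, pd, e0.fderiv_eq, e1.fderiv_eq, fderiv_fun_neg] at h1
  exact h1.symm

/-- The complex derivative `∂_z Y_k` of a coordinate function. -/
def wdata (Y : ℂ → E3) (k : Fin 3) (w : ℂ) : ℂ :=
  (1 / 2) * ((pd Y 0 w k : ℂ) - Complex.I * (pd Y 1 w k : ℂ))

theorem fderiv_coord {Y : ℂ → E3} (hY : DifferentiableAt ℝ Y w) (k : Fin 3) (x : ℂ) :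
    fderiv ℝ (fun v => Y v k) w x = fderiv ℝ Y w x k := by
  have h := (EuclideanSpace.proj k : E3 →L[ℝ] ℝ).hasFDerivAt.comp w hY.hasFDerivAt
  rw [show (fun v => Y v k) = ⇑(EuclideanSpace.proj k : E3 →L[ℝ] ℝ) ∘ Y from rfl, h.fderiv]
  rfl

theorem IsConformalPatch.harmonicAt (h : IsConformalPatch U Y N) (hw : w ∈ U) (k : Fin 3) :
    InnerProductSpace.HarmonicAt (fun v => Y v k) w := by
  have hs (v : ℂ) (hv : v ∈ U) : ContDiffAt ℝ ∞ (fun v => Y v k) v :=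
    (EuclideanSpace.proj k : E3 →L[ℝ] ℝ).contDiff.contDiffAt.comp v (h.smooth v hv)
  refine ⟨(hs w hw).of_le (by simpa using WithTop.coe_le_coe.mpr (le_top (a := (2 : ℕ∞)))), ?_⟩
  filter_upwards [h.isOpen.mem_nhds hw] with v hv
  have hd : DifferentiableAt ℝ (fderiv ℝ (fun v => Y v k)) v :=
    ((hs v hv).fderiv_right (m := ∞) (by simp)).differentiableAt (by simp)
  have key (i : Fin 2) : fderiv ℝ (fderiv ℝ (fun v => Y v k)) v (stdVec i) (stdVec i) =
      pd (pd Y i) i v k := by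
    have h1 : fderiv ℝ (fun u => fderiv ℝ (fun v => Y v k) u (stdVec i)) v (stdVec i) =
        fderiv ℝ (fderiv ℝ (fun v => Y v k)) v (stdVec i) (stdVec i) := by
      rw [fderiv_clm_apply hd (differentiableAt_const _)]
      simp
    have h2 : (fun u => fderiv ℝ (fun v => Y v k) u (stdVec i)) =ᶠ[nhds v]
        fun u => pd Y i u k := by
      filter_upwards [h.isOpen.mem_nhds hv] with u hu
      exact fderiv_coord ((h.smooth u hu).differentiableAt (by simp)) k _
    rw [← h1, h2.fderiv_eq,
      fderiv_coord ((contDiffAt_pd (h.smooth v hv) i).differentiableAt (by simp))]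
    rfl
  have k0 := key 0
  have k1 := key 1
  rw [h.laplace hv] at k1
  simp only [stdVec, Matrix.cons_val_zero, Matrix.cons_val_one, Matrix.cons_val_fin_one,
    PiLp.neg_apply] at k0 k1
  simp only [InnerProductSpace.laplacian_eq_iteratedFDeriv_complexPlane, iteratedFDeriv_two_apply,
    Fin.isValue, Matrix.cons_val_zero, Matrix.cons_val_one, Matrix.cons_val_fin_one, Pi.zero_apply]
  rw [k0, k1, add_neg_cancel]

theorem IsConformalPatch.analyticAt_wdata (h : IsConformalPatch U Y N) (hw : w ∈ U) (k : Fin 3) :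
    AnalyticAt ℂ (wdata Y k) w := by
  refine ((analyticAt_const (v := (1 / 2 : ℂ))).mul
    (HarmonicAt.analyticAt_complex_partial (h.harmonicAt hw k))).congr ?_
  filter_upwards [h.isOpen.mem_nhds hw] with v hv
  simp only [Pi.mul_apply]
  rw [fderiv_coord ((h.smooth v hv).differentiableAt (by simp)),
    fderiv_coord ((h.smooth v hv).differentiableAt (by simp))]
  rfl

theorem fderiv_real_apply_one {f : ℂ → ℂ} (hf : DifferentiableAt ℂ f w) (x : ℂ) :
    fderiv ℝ f w x = x * deriv f w := by
  rw [hf.hasDerivAt.hasFDerivAt.restrictScalars ℝ |>.fderiv]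
  simp

theorem IsConformalPatch.deriv_wdata (h : IsConformalPatch U Y N) (hw : w ∈ U) (k : Fin 3) :
    deriv (wdata Y k) w =
      (1 / 2) * ((pd (pd Y 0) 0 w k : ℂ) - Complex.I * (pd (pd Y 0) 1 w k : ℂ)) := by
  have h1 := fderiv_real_apply_one (h.analyticAt_wdata hw k).differentiableAt 1
  rw [one_mul] at h1
  rw [← h1, pd_comm (h.smooth w hw) 0 1]
  have hd (i : Fin 2) : HasFDerivAt (fun v => (pd Y i v k : ℂ)) _ w :=
    Complex.ofRealCLM.hasFDerivAt.comp w ((EuclideanSpace.proj k : E3 →L[ℝ] ℝ).hasFDerivAt.comp w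
      ((contDiffAt_pd (h.smooth w hw) i).differentiableAt (by simp)).hasFDerivAt)
  have h2 : HasFDerivAt (wdata Y k) _ w :=
    ((hd 0).sub ((hd 1).const_mul Complex.I)).const_mul (1 / 2 : ℂ)
  rw [h2.fderiv]
  rfl

/-- If `(N, φ)` are a unit normal and an isotropic holomorphic tangent field, the stereographic
projection of `N` is holomorphic and computes `N · φ'`. -/
theorem stereographic_analytic {n : Fin 3 → ℂ → ℝ} {φ : Fin 3 → ℂ → ℂ} (hU : IsOpen U)
    (hw : w ∈ U) (hn : ContinuousAt (n 2) w) (hφ : ∀ k, AnalyticAt ℂ (φ k) w)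
    (hunit : ∀ v ∈ U, n 0 v ^ 2 + n 1 v ^ 2 + n 2 v ^ 2 = 1)
    (hiso : ∀ v ∈ U, φ 0 v ^ 2 + φ 1 v ^ 2 + φ 2 v ^ 2 = 0)
    (hG : ∀ v ∈ U, (n 0 v + Complex.I * n 1 v) * (φ 0 v - Complex.I * φ 1 v) =
      (1 - n 2 v) * φ 2 v)
    (hη : ∀ v ∈ U, φ 0 v - Complex.I * φ 1 v = 0 → n 2 v = 1) (hw1 : n 2 w ≠ 1) :
    AnalyticAt ℂ (fun v => (n 0 v + Complex.I * n 1 v) / (1 - n 2 v) : ℂ → ℂ) w ∧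
      n 0 w * deriv (φ 0) w + n 1 w * deriv (φ 1) w + n 2 w * deriv (φ 2) w =
        -(φ 0 w - Complex.I * φ 1 w) *
          deriv (fun v => (n 0 v + Complex.I * n 1 v) / (1 - n 2 v) : ℂ → ℂ) w := by
  set g : ℂ → ℂ := fun v => (n 0 v + Complex.I * n 1 v) / (1 - n 2 v) with hg
  have hn1 (v : ℂ) (hv : n 2 v ≠ 1) : (1 - n 2 v : ℂ) ≠ 0 := by
    rw [sub_ne_zero]; exact_mod_cast hv.symm
  have hev : ∀ᶠ v in nhds w, v ∈ U ∧ n 2 v ≠ 1 :=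
    (hU.eventually_mem hw).and (hn.eventually_ne hw1)
  have hηw : φ 0 w - Complex.I * φ 1 w ≠ 0 := fun h => hw1 (hη w hw h)
  -- Weierstrass form of the isotropic field: with `η = φ₀ - iφ₁` one has `φ₂ = ηg`, and isotropy
  -- then gives `φ₀ + iφ₁ = -ηg²` (`ep` below).
  have e2 : φ 2 =ᶠ[nhds w] fun v => (φ 0 v - Complex.I * φ 1 v) * g v := by
    filter_upwards [hev] with v hv
    have := hG v hv.1
    have := hn1 v hv.2
    simp only [hg]
    field_simp
    linear_combination -hG v hv.1
  have eg : g =ᶠ[nhds w] fun v => φ 2 v / (φ 0 v - Complex.I * φ 1 v) := by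
    filter_upwards [hev, e2] with v hv h2
    have : φ 0 v - Complex.I * φ 1 v ≠ 0 := fun h => hv.2 (hη v hv.1 h)
    rw [h2]
    field_simp
  have haη : AnalyticAt ℂ (fun v => φ 0 v - Complex.I * φ 1 v) w :=
    (hφ 0).sub (analyticAt_const.mul (hφ 1))
  have hag : AnalyticAt ℂ g w := ((hφ 2).div haη hηw).congr eg.symm
  refine ⟨hag, ?_⟩
  have ep : (fun v => φ 0 v + Complex.I * φ 1 v) =ᶠ[nhds w]
      fun v => -((φ 0 v - Complex.I * φ 1 v) * g v * g v) := by
    filter_upwards [hev, e2] with v hv h2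
    have hne : φ 0 v - Complex.I * φ 1 v ≠ 0 := fun h => hv.2 (hη v hv.1 h)
    apply mul_left_cancel₀ hne
    linear_combination hiso v hv.1 - (φ 2 v + (φ 0 v - Complex.I * φ 1 v) * g v) * h2 -
      φ 1 v ^ 2 * Complex.I_sq
  have d0 := (hφ 0).differentiableAt.hasDerivAt
  have d1 := (hφ 1).differentiableAt.hasDerivAt
  have dg := hag.differentiableAt.hasDerivAt
  have dη := d0.sub (d1.const_mul Complex.I)
  have D2 := e2.deriv_eq.trans (dη.mul dg).deriv
  have Dp := ((d0.add (d1.const_mul Complex.I)).deriv.symm.trans ep.deriv_eq).trans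
    (((dη.mul dg).mul dg).neg).deriv
  simp only [Pi.sub_apply, Pi.mul_apply] at D2 Dp
  have hN : (n 0 w : ℂ) + Complex.I * n 1 w = (1 - n 2 w) * g w := by
    simp only [hg]; field_simp [hn1 w hw1]
  have hN' : ((n 0 w : ℂ) - Complex.I * n 1 w) * g w = 1 + n 2 w := by
    have hu : (n 0 w : ℂ) ^ 2 + (n 1 w : ℂ) ^ 2 + (n 2 w : ℂ) ^ 2 = 1 := by
      exact_mod_cast hunit w hw
    apply mul_left_cancel₀ (hn1 w hw1)
    linear_combination -((n 0 w : ℂ) - Complex.I * n 1 w) * hN + hu - (n 1 w : ℂ) ^ 2 * Complex.I_sq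
  have split : (n 0 w : ℂ) * deriv (φ 0) w + n 1 w * deriv (φ 1) w =
      (1 / 2) * ((n 0 w + Complex.I * n 1 w) * (deriv (φ 0) w - Complex.I * deriv (φ 1) w) +
        (n 0 w - Complex.I * n 1 w) * (deriv (φ 0) w + Complex.I * deriv (φ 1) w)) := by
    linear_combination (n 1 w : ℂ) * deriv (φ 1) w * Complex.I_sq
  rw [split, hN, D2, Dp]
  linear_combination -(1 / 2) * ((deriv (φ 0) w - Complex.I * deriv (φ 1) w) * g w +
    2 * (φ 0 w - Complex.I * φ 1 w) * deriv g w) * hN'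

end Conformal

/-! ### The Gauss map and the Hopf differential from the Weierstrass data. -/

section Weierstrass

variable {U : Set ℂ} {Y N : ℂ → E3} {w : ℂ}

theorem IsConformalPatch.cross_normal_left (h : IsConformalPatch U Y N) (hw : w ∈ U) :
    cross (N w) (pd Y 0 w) = pd Y 1 w := by
  rw [h.normal w hw, cross_unitNormal_left (h.cross_ne w hw) (h.inner_self w hw)
    (h.inner_cross w hw)]

theorem IsConformalPatch.cross_normal_right (h : IsConformalPatch U Y N) (hw : w ∈ U) :
    cross (N w) (pd Y 1 w) = -pd Y 0 w := by
  rw [h.normal w hw, cross_unitNormal_right (h.cross_ne w hw) (h.inner_self w hw)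
    (h.inner_cross w hw)]

theorem IsConformalPatch.frame_eqs (h : IsConformalPatch U Y N) (hw : w ∈ U) :
    (N w 1 * pd Y 0 w 2 - N w 2 * pd Y 0 w 1 = pd Y 1 w 0 ∧
      N w 2 * pd Y 0 w 0 - N w 0 * pd Y 0 w 2 = pd Y 1 w 1 ∧
      N w 0 * pd Y 0 w 1 - N w 1 * pd Y 0 w 0 = pd Y 1 w 2) ∧
    (N w 1 * pd Y 1 w 2 - N w 2 * pd Y 1 w 1 = -pd Y 0 w 0 ∧
      N w 2 * pd Y 1 w 0 - N w 0 * pd Y 1 w 2 = -pd Y 0 w 1 ∧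
      N w 0 * pd Y 1 w 1 - N w 1 * pd Y 1 w 0 = -pd Y 0 w 2) ∧
    N w 0 * pd Y 0 w 0 + N w 1 * pd Y 0 w 1 + N w 2 * pd Y 0 w 2 = 0 ∧
    N w 0 * pd Y 1 w 0 + N w 1 * pd Y 1 w 1 + N w 2 * pd Y 1 w 2 = 0 := by
  have hl := h.cross_normal_left hw
  have hr := h.cross_normal_right hw
  have h0 := h.inner_normal_pd hw 0
  have h1 := h.inner_normal_pd hw 1
  rw [inner_eq_coord] at h0 h1
  exact ⟨⟨congrArg (fun v : E3 => v 0) hl, congrArg (fun v : E3 => v 1) hl,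
    congrArg (fun v : E3 => v 2) hl⟩, ⟨congrArg (fun v : E3 => v 0) hr,
    congrArg (fun v : E3 => v 1) hr, congrArg (fun v : E3 => v 2) hr⟩, h0, h1⟩

theorem IsConformalPatch.pd_one_ne_zero (h : IsConformalPatch U Y N) (hw : w ∈ U) :
    pd Y 1 w ≠ 0 := by
  intro h0
  apply h.cross_ne w hw
  rw [h0, ← crossL_apply, map_zero]

theorem IsConformalPatch.wdata_isotropic (h : IsConformalPatch U Y N) (hw : w ∈ U) :
    wdata Y 0 w ^ 2 + wdata Y 1 w ^ 2 + wdata Y 2 w ^ 2 = 0 := by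
  have hs := h.inner_self w hw
  have hc := h.inner_cross w hw
  rw [inner_eq_coord, inner_eq_coord] at hs
  rw [inner_eq_coord] at hc
  apply Complex.ext
  · simp [wdata, sq]; linarith
  · simp [wdata, sq]; linarith

theorem IsConformalPatch.wdata_stereo (h : IsConformalPatch U Y N) (hw : w ∈ U) :
    (N w 0 + Complex.I * N w 1) * (wdata Y 0 w - Complex.I * wdata Y 1 w) =
      (1 - N w 2) * wdata Y 2 w := by
  obtain ⟨⟨-, -, h3⟩, ⟨-, -, h6⟩, h7, h8⟩ := h.frame_eqs hw
  apply Complex.ext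
  · simp [wdata]; linarith
  · simp [wdata]; linarith

theorem IsConformalPatch.wdata_stereo_inv (h : IsConformalPatch U Y N) (hw : w ∈ U) :
    (N w 0 - Complex.I * N w 1) * (wdata Y 0 w + Complex.I * wdata Y 1 w) =
      -((1 + N w 2) * wdata Y 2 w) := by
  obtain ⟨⟨-, -, h3⟩, ⟨-, -, h6⟩, h7, h8⟩ := h.frame_eqs hw
  apply Complex.ext
  · simp [wdata]; linarith
  · simp [wdata]; linarith

/-- If `η = 0` and `N³ ≠ 1`, then `wdata_stereo` forces `φ₂ = 0`, and `N × ∂_x Y = ∂_y Y` gives `∂_y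
Y = 0`, contradicting the immersion property. So `η` vanishes at most at poles of `G`. -/
theorem IsConformalPatch.normal_eq_one (h : IsConformalPatch U Y N) (hw : w ∈ U)
    (hη : wdata Y 0 w - Complex.I * wdata Y 1 w = 0) : N w 2 = 1 := by
  by_contra hne
  have hs := h.wdata_stereo hw
  rw [hη, mul_zero, eq_comm, mul_eq_zero, or_iff_right
    (sub_ne_zero.mpr (by exact_mod_cast Ne.symm hne))] at hs
  have a2 := congrArg Complex.re hs
  have b2 := congrArg Complex.im hs
  have r := congrArg Complex.re hη
  have i := congrArg Complex.im hη
  simp [wdata] at a2 b2 r i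
  obtain ⟨⟨h1, h2, -⟩, -⟩ := h.frame_eqs hw
  rw [a2] at h1 h2
  have hne' : 1 - N w 2 ≠ 0 := sub_ne_zero.mpr (Ne.symm hne)
  apply h.pd_one_ne_zero hw
  apply ext_coord
  · apply (mul_eq_zero_iff_left hne').mp
    linear_combination (2 * N w 2) * i - h1
  · apply (mul_eq_zero_iff_left hne').mp
    linear_combination (2 * N w 2) * r - h2
  · exact b2

theorem IsConformalPatch.normal_eq_neg_one (h : IsConformalPatch U Y N) (hw : w ∈ U)
    (hη : wdata Y 0 w + Complex.I * wdata Y 1 w = 0) : N w 2 = -1 := by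
  by_contra hne
  have hs := h.wdata_stereo_inv hw
  have hne' : 1 + N w 2 ≠ 0 := fun h => hne (by linarith)
  rw [hη, mul_zero, eq_comm, neg_eq_zero, mul_eq_zero, or_iff_right
    (by rw [← Complex.ofReal_one, ← Complex.ofReal_add]; exact Complex.ofReal_ne_zero.mpr hne')] at hs
  have a2 := congrArg Complex.re hs
  have b2 := congrArg Complex.im hs
  have r := congrArg Complex.re hη
  have i := congrArg Complex.im hη
  simp [wdata] at a2 b2 r i
  obtain ⟨⟨h1, h2, -⟩, -⟩ := h.frame_eqs hw
  rw [a2] at h1 h2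
  apply h.pd_one_ne_zero hw
  apply ext_coord
  · apply (mul_eq_zero_iff_left hne').mp
    linear_combination (-2 * N w 2) * i - h1
  · apply (mul_eq_zero_iff_left hne').mp
    linear_combination (2 * N w 2) * r - h2
  · exact b2

/-- The coefficient `2 N · ∂_z² Y` of the Hopf differential. -/
def hopfFun (Y N : ℂ → E3) (w : ℂ) : ℂ :=
  2 * (N w 0 * deriv (wdata Y 0) w + N w 1 * deriv (wdata Y 1) w + N w 2 * deriv (wdata Y 2) w)

theorem IsConformalPatch.hopfFun_re_im (h : IsConformalPatch U Y N) (hw : w ∈ U) :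
    hopfFun Y N w = (inner ℝ (N w) (pd (pd Y 0) 0 w) : ℝ) -
      Complex.I * (inner ℝ (N w) (pd (pd Y 0) 1 w) : ℝ) := by
  rw [hopfFun, h.deriv_wdata hw, h.deriv_wdata hw, h.deriv_wdata hw, inner_eq_coord,
    inner_eq_coord]
  push_cast
  ring

/-- The stereographic projection of the normal. -/
def stereoFun (N : ℂ → E3) (w : ℂ) : ℂ := (N w 0 + Complex.I * N w 1) / (1 - N w 2)

/-- The reciprocal of the stereographic projection of the normal. -/
def stereoInvFun (N : ℂ → E3) (w : ℂ) : ℂ := (N w 0 - Complex.I * N w 1) / (1 + N w 2)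

theorem IsConformalPatch.normal_sq (h : IsConformalPatch U Y N) (hw : w ∈ U) :
    N w 0 ^ 2 + N w 1 ^ 2 + N w 2 ^ 2 = 1 := by
  have := h.inner_normal_self hw
  rw [inner_eq_coord] at this
  linarith

theorem IsConformalPatch.continuousAt_coord (h : IsConformalPatch U Y N) (hw : w ∈ U)
    (k : Fin 3) : ContinuousAt (fun v => N v k) w :=
  (EuclideanSpace.proj k : E3 →L[ℝ] ℝ).continuous.continuousAt.comp
    (h.contDiffAt_normal hw).continuousAt

theorem IsConformalPatch.stereoFun_analytic (h : IsConformalPatch U Y N) (hw : w ∈ U)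
    (h1 : N w 2 ≠ 1) : AnalyticAt ℂ (stereoFun N) w ∧
      hopfFun Y N w = -2 * (wdata Y 0 w - Complex.I * wdata Y 1 w) * deriv (stereoFun N) w := by
  have key := stereographic_analytic (n := fun k v => N v k) (φ := wdata Y) h.isOpen hw
    (h.continuousAt_coord hw 2) (h.analyticAt_wdata hw) (fun v hv => h.normal_sq hv)
    (fun v hv => h.wdata_isotropic hv) (fun v hv => h.wdata_stereo hv)
    (fun v hv => h.normal_eq_one hv) h1
  refine ⟨key.1, ?_⟩
  rw [hopfFun, key.2]
  change 2 * (_ * deriv (stereoFun N) w) = _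
  ring

/-- The half turn about the first axis, `(x₀, x₁, x₂) ↦ (x₀, -x₁, -x₂)`, replaces `G` by `1/G`, so
the general stereographic statement is applied to the rotated data. -/
theorem IsConformalPatch.stereoInvFun_analytic (h : IsConformalPatch U Y N) (hw : w ∈ U)
    (h1 : N w 2 ≠ -1) : AnalyticAt ℂ (stereoInvFun N) w ∧
      hopfFun Y N w = -2 * (wdata Y 0 w + Complex.I * wdata Y 1 w) * deriv (stereoInvFun N) w := by
  have key := stereographic_analytic (n := ![fun v => N v 0, fun v => -N v 1, fun v => -N v 2])
    (φ := ![wdata Y 0, fun v => -wdata Y 1 v, fun v => -wdata Y 2 v]) h.isOpen hw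
    (h.continuousAt_coord hw 2).neg
    (fun k => by
      fin_cases k
      · exact h.analyticAt_wdata hw 0
      · exact (h.analyticAt_wdata hw 1).neg
      · exact (h.analyticAt_wdata hw 2).neg)
    (fun v hv => by simpa using h.normal_sq hv)
    (fun v hv => by simpa using h.wdata_isotropic hv)
    (fun v hv => by
      simp
      linear_combination h.wdata_stereo_inv hv)
    (fun v hv h0 => by
      have := h.normal_eq_neg_one hv (by simpa using h0)
      simp [this])
    (by simpa [neg_eq_iff_eq_neg] using h1)
  have e : (fun v => ((![fun v => N v 0, fun v => -N v 1, fun v => -N v 2] : Fin 3 → ℂ → ℝ) 0 v +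
      Complex.I * (![fun v => N v 0, fun v => -N v 1, fun v => -N v 2] : Fin 3 → ℂ → ℝ) 1 v) /
      (1 - (![fun v => N v 0, fun v => -N v 1, fun v => -N v 2] : Fin 3 → ℂ → ℝ) 2 v) : ℂ → ℂ) =
      stereoInvFun N := by
    funext v
    simp [stereoInvFun, sub_eq_add_neg]
  rw [e] at key
  refine ⟨key.1, ?_⟩
  have k2 := key.2
  simp [deriv.fun_neg] at k2
  rw [hopfFun]
  linear_combination 2 * k2

theorem IsConformalPatch.analyticAt_hopfFun (h : IsConformalPatch U Y N) (hw : w ∈ U) :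
    AnalyticAt ℂ (hopfFun Y N) w := by
  have h0 := h.analyticAt_wdata hw 0
  have hI := (analyticAt_const (v := Complex.I)).mul (h.analyticAt_wdata hw 1)
  by_cases h1 : N w 2 = 1
  · have hne : N w 2 ≠ -1 := by rw [h1]; norm_num
    refine (((analyticAt_const (v := (-2 : ℂ))).mul (h0.add hI)).mul
      (h.stereoInvFun_analytic hw hne).1.deriv).congr ?_
    filter_upwards [h.isOpen.eventually_mem hw,
      (h.continuousAt_coord hw 2).eventually_ne hne] with v hv hv1
    exact (h.stereoInvFun_analytic hv hv1).2.symm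
  · refine (((analyticAt_const (v := (-2 : ℂ))).mul (h0.sub hI)).mul
      (h.stereoFun_analytic hw h1).1.deriv).congr ?_
    filter_upwards [h.isOpen.eventually_mem hw,
      (h.continuousAt_coord hw 2).eventually_ne h1] with v hv hv1
    exact (h.stereoFun_analytic hv hv1).2.symm

end Weierstrass

/-! ### Curvature and the flat connection in a holomorphic coordinate -/

section Curvature

variable {M : Type*} [TopologicalSpace M] [ChartedSpace ℂ M] [IsManifold 𝓘(ℝ, ℂ) ∞ M]
variable {X : M → E3} {z : OpenPartialHomeomorph M ℂ} {w : ℂ}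

theorem IsHolomorphicCoord.hopfCoeff_eq (hz : IsHolomorphicCoord X z) (hX : IsMinimalImmersion X)
    (hw : w ∈ z.target) :
    hopfCoeff X z w = hopfFun (fun v => X (z.symm v)) (fun v => gaussMap X (z.symm v)) w := by
  have hP := hz.isConformalPatch hX
  rw [hopfCoeff, hz.isOrientedChart.secondForm_eq hX hw, hz.isOrientedChart.secondForm_eq hX hw,
    hP.hopfFun_re_im hw, hP.inner_pd_normal_pd hw, hP.inner_pd_normal_pd hw]

theorem IsHolomorphicCoord.analyticAt_hopfCoeff (hz : IsHolomorphicCoord X z)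
    (hX : IsMinimalImmersion X) (hw : w ∈ z.target) : AnalyticAt ℂ (hopfCoeff X z) w := by
  refine ((hz.isConformalPatch hX).analyticAt_hopfFun hw).congr ?_
  filter_upwards [z.open_target.eventually_mem hw] with v hv
  exact (hz.hopfCoeff_eq hX hv).symm

theorem IsHolomorphicCoord.secondMatrix_eq (hz : IsHolomorphicCoord X z)
    (hX : IsMinimalImmersion X) (hw : w ∈ z.target) :
    secondMatrix X z w = !![(hopfCoeff X z w).re, -(hopfCoeff X z w).im;
      -(hopfCoeff X z w).im, -(hopfCoeff X z w).re] := by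
  have hP := hz.isConformalPatch hX
  have hA (i j : Fin 2) : secondForm X (z.symm w) (coordVec z w i) (coordVec z w j) = _ :=
    (hz.isOrientedChart.secondForm_eq hX hw i j).trans (hP.inner_pd_normal_pd hw i j)
  have h01 := hA 0 1
  rw [← pd_comm (hP.smooth w hw) 0 1, ← hA 1 0] at h01
  have h11 := hA 1 1
  rw [hP.laplace hw, inner_neg_right, ← hA 0 0] at h11
  have hre : (hopfCoeff X z w).re =
    secondForm X (z.symm w) (coordVec z w 0) (coordVec z w 0) := by simp [hopfCoeff]
  have him : -(hopfCoeff X z w).im =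
    secondForm X (z.symm w) (coordVec z w 1) (coordVec z w 0) := by simp [hopfCoeff]
  rw [hre, him, ← h11]
  ext i j
  fin_cases i <;> fin_cases j
  · rfl
  · exact h01
  · rfl
  · rfl

/-- The conformal factor of the induced metric. -/
def conformalFactor (X : M → E3) (z : OpenPartialHomeomorph M ℂ) (w : ℂ) : ℝ :=
  inducedMetric X (z.symm w) (coordVec z w 0) (coordVec z w 0)

theorem IsHolomorphicCoord.conformalFactor_pos (hz : IsHolomorphicCoord X z)
    (hX : IsMinimalImmersion X) (hw : w ∈ z.target) : 0 < conformalFactor X z w := by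
  have hP := hz.isConformalPatch hX
  rw [conformalFactor, hz.isOrientedChart.inducedMetric_eq hX hw, hP.inner_self w hw,
    real_inner_self_eq_norm_sq]
  have := norm_pos_iff.mpr (hP.pd_one_ne_zero hw)
  positivity

theorem IsHolomorphicCoord.inducedMetric_coord (hz : IsHolomorphicCoord X z)
    (hw : w ∈ z.target) (i j : Fin 2) :
    inducedMetric X (z.symm w) (coordVec z w i) (coordVec z w j) =
      (conformalFactor X z w • (1 : Matrix (Fin 2) (Fin 2) ℝ)) i j := by
  obtain ⟨h1, h2⟩ := hz.conformal w hw
  fin_cases i <;> fin_cases j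
  · simp [conformalFactor]
  · simpa using h2
  · simpa [inducedMetric, real_inner_comm] using h2
  · simpa [conformalFactor] using h1.symm

theorem IsHolomorphicCoord.shape_eq (hz : IsHolomorphicCoord X z)
    (hX : IsMinimalImmersion X) (hw : w ∈ z.target) :
    (firstMatrix X z w)⁻¹ * secondMatrix X z w =
      (conformalFactor X z w)⁻¹ • !![(hopfCoeff X z w).re, -(hopfCoeff X z w).im;
        -(hopfCoeff X z w).im, -(hopfCoeff X z w).re] := by
  have hpos := hz.conformalFactor_pos hX hw
  have h1 : firstMatrix X z w = conformalFactor X z w • (1 : Matrix (Fin 2) (Fin 2) ℝ) := by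
    ext i j
    exact hz.inducedMetric_coord hw i j
  rw [h1, hz.secondMatrix_eq hX hw]
  have h2 : (conformalFactor X z w • (1 : Matrix (Fin 2) (Fin 2) ℝ))⁻¹ =
      (conformalFactor X z w)⁻¹ • (1 : Matrix (Fin 2) (Fin 2) ℝ) := by
    apply Matrix.inv_eq_right_inv
    rw [Matrix.smul_mul, Matrix.one_mul, smul_smul, mul_inv_cancel₀ hpos.ne', one_smul]
  rw [h2, Matrix.smul_mul, Matrix.one_mul]

/-- The shape operator is a trace-free matrix built from `q`, and a trace-free matrix is scalar only
when it is zero. -/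
theorem IsHolomorphicCoord.isUmbilic_iff (hz : IsHolomorphicCoord X z)
    (hX : IsMinimalImmersion X) (hw : w ∈ z.target) :
    IsUmbilic X (z.symm w) ↔ hopfCoeff X z w = 0 := by
  have hpos := inv_pos.mpr (hz.conformalFactor_pos hX hw)
  rw [hz.isOrientedChart.isUmbilic_iff hw, hz.shape_eq hX hw]
  constructor
  · rintro ⟨κ, hκ⟩
    have h00 := congrArg (fun A => A 0 0) hκ
    have h01 := congrArg (fun A => A 0 1) hκ
    have h11 := congrArg (fun A => A 1 1) hκ
    simp [hpos.ne'] at h00 h01 h11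
    apply Complex.ext
    · apply (mul_eq_zero_iff_left hpos.ne').mp
      linarith
    · exact h01
  · intro h
    refine ⟨0, ?_⟩
    rw [h]
    ext i j
    fin_cases i <;> fin_cases j <;> simp

theorem IsHolomorphicCoord.gaussCurvature_eq (hz : IsHolomorphicCoord X z)
    (hX : IsMinimalImmersion X) (hw : w ∈ z.target) :
    gaussCurvature X (z.symm w) = -(‖hopfCoeff X z w‖ / conformalFactor X z w) ^ 2 := by
  rw [hz.isOrientedChart.gaussCurvature_eq hw, hz.shape_eq hX hw, Matrix.det_smul,
    Matrix.det_fin_two_of, div_pow, Complex.sq_norm, Complex.normSq_apply, Fintype.card_fin]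
  have := (hz.conformalFactor_pos hX hw).ne'
  field_simp
  ring

/-- For `g = ρ|dz|²` one has `√(-K) = |q|/ρ`, so the conformal factor cancels and only the Hopf
differential remains. -/
theorem IsHolomorphicCoord.flatMetric_eq (hz : IsHolomorphicCoord X z)
    (hX : IsMinimalImmersion X) (hw : w ∈ z.target) :
    flatMetric X z w = ‖hopfCoeff X z w‖ • (1 : Matrix (Fin 2) (Fin 2) ℝ) := by
  have hpos := hz.conformalFactor_pos hX hw
  ext i j
  rw [flatMetric, Matrix.of_apply, hz.gaussCurvature_eq hX hw, neg_neg,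
    Real.sqrt_sq (by positivity), hz.inducedMetric_coord hw]
  simp only [Matrix.smul_apply, smul_eq_mul]
  field_simp

theorem christoffel_conformal {h : ℂ → Matrix (Fin 2) (Fin 2) ℝ} {ρ : ℂ → ℝ}
    (hh : ∀ᶠ v in nhds w, h v = ρ v • (1 : Matrix (Fin 2) (Fin 2) ℝ)) (hρ : ρ w ≠ 0) :
    christoffel h w 0 0 0 = fderiv ℝ ρ w 1 / (2 * ρ w) ∧
      christoffel h w 0 1 1 = -(fderiv ℝ ρ w 1 / (2 * ρ w)) ∧
      christoffel h w 0 0 1 = fderiv ℝ ρ w Complex.I / (2 * ρ w) := by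
  have hinv : (h w)⁻¹ = (ρ w)⁻¹ • (1 : Matrix (Fin 2) (Fin 2) ℝ) := by
    rw [hh.self_of_nhds]
    apply Matrix.inv_eq_right_inv
    rw [Matrix.smul_mul, Matrix.one_mul, smul_smul, mul_inv_cancel₀ hρ, one_smul]
  have hd (k i : Fin 2) : metricDeriv h w k i i = fderiv ℝ ρ w (stdVec k) := by
    have : (fun v => h v i i) =ᶠ[nhds w] ρ := by
      filter_upwards [hh] with v hv
      rw [hv]; simp
    rw [metricDeriv, this.fderiv_eq]
  have ho (k i j : Fin 2) (hij : i ≠ j) : metricDeriv h w k i j = 0 := by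
    have : (fun v => h v i j) =ᶠ[nhds w] fun _ => (0 : ℝ) := by
      filter_upwards [hh] with v hv
      rw [hv]; simp [Matrix.one_apply_ne hij]
    rw [metricDeriv, this.fderiv_eq]; simp
  have h01 (k : Fin 2) : metricDeriv h w k 0 1 = 0 := ho k 0 1 (by decide)
  have h10 (k : Fin 2) : metricDeriv h w k 1 0 = 0 := ho k 1 0 (by decide)
  have e0 : stdVec 0 = 1 := rfl
  have e1 : stdVec 1 = Complex.I := rfl
  refine ⟨?_, ?_, ?_⟩ <;>
    (simp only [christoffel, hinv, Fin.sum_univ_two, hd, h01, h10, e0, e1, Matrix.smul_apply,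
      Matrix.one_apply_eq, smul_eq_mul]; simp; field_simp; try ring)

theorem fderiv_norm_apply {q : ℂ → ℂ} (hq : DifferentiableAt ℂ q w) (h0 : q w ≠ 0) (x : ℂ) :
    fderiv ℝ (fun v => ‖q v‖) w x = ((starRingEnd ℂ (q w)) * (x * deriv q w)).re / ‖q w‖ := by
  have hqr : DifferentiableAt ℝ q w := hq.restrictScalars ℝ
  have hn : DifferentiableAt ℝ (fun v => ‖q v‖) w := hqr.norm ℝ h0
  have h1 : HasFDerivAt (fun v => ‖q v‖ ^ 2) _ w := hn.hasFDerivAt.pow 2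
  have h2 : HasFDerivAt (fun v => ‖q v‖ ^ 2) _ w := hqr.hasFDerivAt.norm_sq
  have h3 := congrArg (fun L : ℂ →L[ℝ] ℝ => L x) (h1.unique h2)
  simp [fderiv_real_apply_one hq] at h3
  have := norm_pos_iff.mpr h0
  rw [eq_div_iff this.ne']
  simp
  linarith

/-- For a conformal metric `ρ|dz|²` the coefficient is `γ = ∂_z log ρ`; with `ρ = |q|` and `q`
holomorphic this is half the logarithmic derivative of `q`. -/
theorem IsHolomorphicCoord.gammaCoeff_eq (hz : IsHolomorphicCoord X z)
    (hX : IsMinimalImmersion X) (hw : w ∈ z.target) (h0 : hopfCoeff X z w ≠ 0) :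
    gammaCoeff X z w = deriv (hopfCoeff X z) w / (2 * hopfCoeff X z w) := by
  obtain ⟨h1, h2, h3⟩ := christoffel_conformal (h := flatMetric X z)
    (ρ := fun v => ‖hopfCoeff X z v‖)
    (by filter_upwards [z.open_target.eventually_mem hw] with v hv using hz.flatMetric_eq hX hv)
    (norm_ne_zero_iff.mpr h0)
  have hd := (hz.analyticAt_hopfCoeff hX hw).differentiableAt
  rw [fderiv_norm_apply hd h0] at h1 h2 h3
  simp only [gammaCoeff, h1, h2, h3]
  set q := hopfCoeff X z w
  set q' := deriv (hopfCoeff X z) w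
  have hn : (‖q‖ : ℂ) ≠ 0 := by exact_mod_cast norm_ne_zero_iff.mpr h0
  have hs : (‖q‖ : ℂ) ^ 2 = starRingEnd ℂ q * q := (Complex.conj_mul' q).symm
  have hsplit : starRingEnd ℂ q * q' = ((starRingEnd ℂ q * (1 * q')).re : ℂ) -
      Complex.I * ((starRingEnd ℂ q * (Complex.I * q')).re : ℂ) := by
    apply Complex.ext <;> simp; ring
  generalize (starRingEnd ℂ q * (1 * q')).re = a at hsplit ⊢
  generalize (starRingEnd ℂ q * (Complex.I * q')).re = b at hsplit ⊢
  push_cast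
  rw [eq_div_iff (mul_ne_zero two_ne_zero h0)]
  apply mul_left_cancel₀ (pow_ne_zero 2 hn)
  field_simp
  rw [hs]
  linear_combination (-2 * q) * hsplit

end Curvature

/-! ### Schwarzian derivatives at a zero of the Hopf differential -/

section LocalAnalysis

open Filter Topology

theorem wirtinger_eq_deriv {s : ℂ → ℂ} {w : ℂ} (h : DifferentiableAt ℂ s w) :
    wirtinger s w = deriv s w := by
  rw [wirtinger, fderiv_real_apply_one h, fderiv_real_apply_one h]
  linear_combination (-1 / 2) * deriv s w * Complex.I_sq

theorem nablaOneZero_of_eventuallyEq {γ s t : ℂ → ℂ} {w : ℂ} (ℓ : ℕ) (hst : s =ᶠ[𝓝 w] t)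
    (ht : DifferentiableAt ℂ t w) : nablaOneZero γ ℓ s w = deriv t w - ℓ * γ w * t w := by
  rw [nablaOneZero, hst.self_of_nhds, ← wirtinger_eq_deriv ht, wirtinger, wirtinger, hst.fderiv_eq]

/-- The covariant derivatives are `f'' - γf'` and `f''' - 3γf'' - γ'f' + 2γ²f'`. In the Schwarzian
the terms in `γf''/f'` cancel, so the connection contributes only `-γ' + γ²/2`. -/
theorem schwarzian_eq {γ f : ℂ → ℂ} {w : ℂ} (hγ : AnalyticAt ℂ γ w) (hf : AnalyticAt ℂ f w)
    (h0 : deriv f w ≠ 0) :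
    schwarzian γ f w = deriv (deriv (deriv f)) w / deriv f w -
      (3 / 2) * (deriv (deriv f) w / deriv f w) ^ 2 - deriv γ w + γ w ^ 2 / 2 := by
  have e1 : nablaOneZero γ 0 f =ᶠ[𝓝 w] deriv f := by
    filter_upwards [hf.eventually_analyticAt] with v hv
    rw [nablaOneZero_of_eventuallyEq 0 EventuallyEq.rfl hv.differentiableAt]
    simp
  have e2 : nablaOneZero γ 1 (nablaOneZero γ 0 f) =ᶠ[𝓝 w]
      fun v => deriv (deriv f) v - γ v * deriv f v := by
    filter_upwards [hf.eventually_analyticAt, e1.eventually_nhds] with v hv hv1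
    rw [nablaOneZero_of_eventuallyEq 1 hv1 hv.deriv.differentiableAt]
    simp
  have d1 := hf.deriv.differentiableAt.hasDerivAt
  have d2 := hf.deriv.deriv.differentiableAt.hasDerivAt
  have d3 := d2.sub (hγ.differentiableAt.hasDerivAt.mul d1)
  have e3 : nablaOneZero γ 2 (nablaOneZero γ 1 (nablaOneZero γ 0 f)) w = _ :=
    nablaOneZero_of_eventuallyEq 2 e2 d3.differentiableAt
  simp only [schwarzian]
  rw [e3, e2.self_of_nhds, e1.self_of_nhds,
    show deriv (fun v => deriv (deriv f) v - γ v * deriv f v) w = _ from d3.deriv]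
  push_cast
  field_simp
  ring

/-- The Schwarzian derivative is invariant under `h ↦ 1 / h`. -/
theorem schwarzian_inv {γ f h : ℂ → ℂ} {w : ℂ} (hγ : AnalyticAt ℂ γ w) (hh : AnalyticAt ℂ h w)
    (h0 : deriv h w ≠ 0) (hne : h w ≠ 0) (hf : f =ᶠ[𝓝 w] fun v => (h v)⁻¹) :
    schwarzian γ f w = schwarzian γ h w := by
  have hfa : AnalyticAt ℂ f w := (hh.inv hne).congr hf.symm
  have e1 : deriv f =ᶠ[𝓝 w] fun v => -deriv h v / h v ^ 2 := by
    filter_upwards [hf.eventually_nhds, hh.eventually_analyticAt,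
      hh.continuousAt.eventually_ne hne] with v hv hav hnv
    rw [EventuallyEq.deriv_eq hv]
    exact (hav.differentiableAt.hasDerivAt.inv hnv).deriv
  have e2 : deriv (deriv f) =ᶠ[𝓝 w]
      fun v => -deriv (deriv h) v / h v ^ 2 + 2 * deriv h v ^ 2 / h v ^ 3 := by
    filter_upwards [e1.eventually_nhds, hh.eventually_analyticAt,
      hh.continuousAt.eventually_ne hne] with v hv hav hnv
    rw [EventuallyEq.deriv_eq hv]
    have d := hav.differentiableAt.hasDerivAt
    have d1 := hav.deriv.differentiableAt.hasDerivAt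
    refine ((d1.neg.div (d.pow 2) (pow_ne_zero 2 hnv)).deriv).trans ?_
    simp
    field_simp
  have d := hh.differentiableAt.hasDerivAt
  have d1 := hh.deriv.differentiableAt.hasDerivAt
  have d2 := hh.deriv.deriv.differentiableAt.hasDerivAt
  have e3 : deriv (deriv (deriv f)) w = -deriv (deriv (deriv h)) w / h w ^ 2 +
      6 * deriv h w * deriv (deriv h) w / h w ^ 3 - 6 * deriv h w ^ 3 / h w ^ 4 := by
    rw [e2.deriv_eq]
    refine (((d2.neg.div (d.pow 2) (pow_ne_zero 2 hne)).add (((d1.pow 2).const_mul 2).div (d.pow 3)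
      (pow_ne_zero 3 hne))).deriv).trans ?_
    simp
    field_simp
    ring
  have hf0 : deriv f w ≠ 0 := by
    rw [e1.self_of_nhds]
    exact div_ne_zero (neg_ne_zero.mpr h0) (pow_ne_zero 2 hne)
  rw [schwarzian_eq hγ hfa hf0, schwarzian_eq hγ hh h0, e3, e2.self_of_nhds, e1.self_of_nhds]
  field_simp
  ring

/-- Allows identities that hold on a punctured neighbourhood to be differentiated there. -/
theorem eventually_nhdsNE_nhds {P : ℂ → Prop} {z₀ : ℂ} (h : ∀ᶠ w in 𝓝[≠] z₀, P w) :
    ∀ᶠ w in 𝓝[≠] z₀, ∀ᶠ v in 𝓝 w, P v := by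
  filter_upwards [eventually_eventually_nhdsWithin.mpr h, self_mem_nhdsWithin] with w hw hne
  rwa [isOpen_compl_singleton.nhdsWithin_eq hne] at hw

/-- Each `∇^{1,0}` raises the pole order by one and keeps the numerator analytic. At `z₀` the new
numerator is `-ℓ(1 + R(z₀)/2)` times the old one. -/
theorem nablaOneZero_laurent {γ R A p : ℂ → ℂ} {z₀ : ℂ} (ℓ : ℕ)
    (hA : AnalyticAt ℂ A z₀) (hγ : ∀ᶠ w in 𝓝[≠] z₀, γ w = R w / (2 * (w - z₀)))
    (hp : ∀ᶠ w in 𝓝[≠] z₀, p w = A w / (w - z₀) ^ ℓ) :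
    ∀ᶠ w in 𝓝[≠] z₀, nablaOneZero γ ℓ p w =
      ((w - z₀) * deriv A w - ℓ * A w - ℓ * R w * A w / 2) / (w - z₀) ^ (ℓ + 1) := by
  filter_upwards [eventually_nhdsNE_nhds hp, hγ, self_mem_nhdsWithin,
    hA.eventually_analyticAt.filter_mono nhdsWithin_le_nhds] with w hpw hγw hne hAw
  have hne' : w - z₀ ≠ 0 := sub_ne_zero.mpr hne
  have d := hAw.differentiableAt.hasDerivAt.div (((hasDerivAt_id w).sub_const z₀).pow ℓ)
    (pow_ne_zero ℓ hne')
  rw [nablaOneZero_of_eventuallyEq ℓ hpw d.differentiableAt,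
    show deriv (fun v => A v / (v - z₀) ^ ℓ) w = _ from d.deriv, hγw]
  rcases ℓ with _ | m
  · simp
    field_simp
  · simp
    field_simp
    ring

/-- `R = (w - z₀)q'/q` and `L = (w - z₀)f''/f'` are analytic with value `n` at `z₀`, since `f'` and
`q` differ by a unit. The classical Schwarzian contributes `-n - n²/2` to the double pole and `-γ' +
γ²/2` contributes `n/2 + n²/8`. -/
theorem schwarzian_laurent {q f v γ : ℂ → ℂ} {z₀ : ℂ} {n : ℕ} (hq : AnalyticAt ℂ q z₀)
    (hord : analyticOrderAt q z₀ = n) (hv : AnalyticAt ℂ v z₀) (hv0 : v z₀ ≠ 0)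
    (hf : AnalyticAt ℂ f z₀) (hfv : ∀ᶠ w in 𝓝 z₀, deriv f w = q w * v w)
    (hγ : ∀ᶠ w in 𝓝[≠] z₀, γ w = deriv q w / (2 * q w)) :
    ∃ R A : ℂ → ℂ, AnalyticAt ℂ R z₀ ∧ AnalyticAt ℂ A z₀ ∧ R z₀ = n ∧
      A z₀ = -(3 * n ^ 2 + 4 * n) / 8 ∧ (∀ᶠ w in 𝓝[≠] z₀, γ w = R w / (2 * (w - z₀))) ∧
      ∀ᶠ w in 𝓝[≠] z₀, schwarzian γ f w = A w / (w - z₀) ^ 2 := by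
  obtain ⟨k, hk, hk0, hqk⟩ := hq.analyticOrderAt_eq_natCast.mp hord
  simp only [smul_eq_mul] at hqk
  set R : ℂ → ℂ := fun w => n + (w - z₀) * (deriv k w / k w) with hR
  set L : ℂ → ℂ := fun w => R w + (w - z₀) * (deriv v w / v w) with hL
  have hid : AnalyticAt ℂ (fun w : ℂ => w - z₀) z₀ := analyticAt_id.sub analyticAt_const
  have hRa : AnalyticAt ℂ R z₀ := analyticAt_const.add (hid.mul (hk.deriv.div hk hk0))
  have hLa : AnalyticAt ℂ L z₀ := hRa.add (hid.mul (hv.deriv.div hv hv0))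
  have hR0 : R z₀ = n := by simp [hR]
  have hL0 : L z₀ = n := by simp [hL, hR0]
  have up {P : ℂ → Prop} (h : ∀ᶠ w in 𝓝 z₀, P w) : ∀ᶠ w in 𝓝[≠] z₀, P w :=
    h.filter_mono nhdsWithin_le_nhds
  have hne : ∀ᶠ w in 𝓝[≠] z₀, w - z₀ ≠ 0 := by
    filter_upwards [self_mem_nhdsWithin] with w hw using sub_ne_zero.mpr hw
  have hq0 : ∀ᶠ w in 𝓝[≠] z₀, q w ≠ 0 := by
    filter_upwards [up hqk, hne, up (hk.continuousAt.eventually_ne hk0)] with w h1 h2 h3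
    rw [h1]
    exact mul_ne_zero (pow_ne_zero n h2) h3
  have hqR : ∀ᶠ w in 𝓝[≠] z₀, deriv q w = R w / (w - z₀) * q w := by
    filter_upwards [up hqk.eventually_nhds, hne, up hk.eventually_analyticAt,
      up (hk.continuousAt.eventually_ne hk0)] with w h1 h2 h3 h4
    have d := (((hasDerivAt_id w).sub_const z₀).pow n).mul h3.differentiableAt.hasDerivAt
    rw [EventuallyEq.deriv_eq h1, h1.self_of_nhds,
      show deriv (fun v => (v - z₀) ^ n * k v) w = _ from d.deriv]
    rcases n with _ | m
    · simp [hR]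
      field_simp
    · simp [hR]
      field_simp
      ring
  have hγR : ∀ᶠ w in 𝓝[≠] z₀, γ w = R w / (2 * (w - z₀)) := by
    filter_upwards [hγ, hqR, hq0, hne] with w h1 h2 h3 h4
    rw [h1, h2]
    field_simp
  have hF0 : ∀ᶠ w in 𝓝[≠] z₀, deriv f w ≠ 0 := by
    filter_upwards [up hfv, hq0, up (hv.continuousAt.eventually_ne hv0)] with w h1 h2 h3
    rw [h1]
    exact mul_ne_zero h2 h3
  have hFL : ∀ᶠ w in 𝓝[≠] z₀, deriv (deriv f) w = L w / (w - z₀) * deriv f w := by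
    filter_upwards [up hfv.eventually_nhds, hqR, hne, up hv.eventually_analyticAt,
      up hq.eventually_analyticAt, up (hv.continuousAt.eventually_ne hv0)] with w h1 h2 h3 h4 h5 h6
    have d := h5.differentiableAt.hasDerivAt.mul h4.differentiableAt.hasDerivAt
    rw [EventuallyEq.deriv_eq h1, h1.self_of_nhds,
      show deriv (fun w => q w * v w) w = _ from d.deriv, h2]
    simp only [hL]
    field_simp
  have hFL2 : ∀ᶠ w in 𝓝[≠] z₀, deriv (deriv (deriv f)) w =
      (((w - z₀) * deriv L w - L w + L w ^ 2) / (w - z₀) ^ 2) * deriv f w := by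
    filter_upwards [eventually_nhdsNE_nhds hFL, hne, up hLa.eventually_analyticAt,
      up hf.eventually_analyticAt] with w h1 h2 h3 h4
    have d := (h3.differentiableAt.hasDerivAt.div ((hasDerivAt_id w).sub_const z₀) h2).mul
      h4.deriv.differentiableAt.hasDerivAt
    rw [EventuallyEq.deriv_eq h1,
      show deriv (fun w => L w / (w - z₀) * deriv f w) w = _ from d.deriv, h1.self_of_nhds]
    simp
    field_simp
  refine ⟨R, fun w => (w - z₀) * deriv L w - L w - L w ^ 2 / 2 -
    ((w - z₀) * deriv R w - R w) / 2 + R w ^ 2 / 8, hRa, ?_, hR0, ?_, hγR, ?_⟩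
  · exact ((((hid.mul hLa.deriv).sub hLa).sub ((hLa.pow 2).div_const)).sub
      (((hid.mul hRa.deriv).sub hRa).div_const)).add ((hRa.pow 2).div_const)
  · simp only [hL0, hR0]
    ring
  · filter_upwards [eventually_nhdsNE_nhds hγR, hFL, hFL2, hF0, hne,
      up hf.eventually_analyticAt, up hRa.eventually_analyticAt] with w h1 h2 h3 h4 h5 h6 h7
    have hlin : AnalyticAt ℂ (fun u : ℂ => 2 * (u - z₀)) w :=
      analyticAt_const.mul (analyticAt_id.sub analyticAt_const)
    have hγa : AnalyticAt ℂ γ w :=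
      (h7.div hlin (mul_ne_zero two_ne_zero h5)).congr (EventuallyEq.symm h1)
    have d := h7.differentiableAt.hasDerivAt.div (((hasDerivAt_id w).sub_const z₀).const_mul 2)
      (mul_ne_zero two_ne_zero h5)
    rw [schwarzian_eq hγa h6 h4, h3, h2, EventuallyEq.deriv_eq h1, h1.self_of_nhds,
      show deriv (fun w => R w / (2 * (w - z₀))) w = _ from d.deriv]
    simp
    field_simp
    ring

end LocalAnalysis

/-! ### Umbilic points -/

section Umbilics

open Filter Topology

variable {M : Type*} [TopologicalSpace M] [ChartedSpace ℂ M] [IsManifold 𝓘(ℝ, ℂ) ∞ M]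
variable {X : M → E3} {z : OpenPartialHomeomorph M ℂ}

theorem IsHolomorphicCoord.analyticAt_gammaCoeff (hz : IsHolomorphicCoord X z)
    (hX : IsMinimalImmersion X) {w : ℂ} (hw : w ∈ z.target) (h0 : hopfCoeff X z w ≠ 0) :
    AnalyticAt ℂ (gammaCoeff X z) w := by
  have hq := hz.analyticAt_hopfCoeff hX hw
  have h2q : AnalyticAt ℂ (fun v => 2 * hopfCoeff X z v) w := analyticAt_const.mul hq
  refine (hq.deriv.div h2q (mul_ne_zero two_ne_zero h0)).congr ?_
  filter_upwards [z.open_target.eventually_mem hw, hq.continuousAt.eventually_ne h0] with v hv hv0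
  exact (hz.gammaCoeff_eq hX hv hv0).symm

/-- Near every point `P₂` is the Schwarzian derivative of a single holomorphic function whose
derivative is a nowhere vanishing multiple of the Hopf differential. -/
theorem IsHolomorphicCoord.exists_schwarzianGauss_eq (hz : IsHolomorphicCoord X z)
    (hX : IsMinimalImmersion X) {z₀ : ℂ} (h₀ : z₀ ∈ z.target)
    (hq : ∀ᶠ w in 𝓝[≠] z₀, hopfCoeff X z w ≠ 0) :
    ∃ f v : ℂ → ℂ, AnalyticAt ℂ f z₀ ∧ AnalyticAt ℂ v z₀ ∧ v z₀ ≠ 0 ∧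
      (∀ᶠ w in 𝓝 z₀, deriv f w = hopfCoeff X z w * v w) ∧
      ∀ᶠ w in 𝓝[≠] z₀, schwarzianGauss X z w = schwarzian (gammaCoeff X z) f w := by
  have hP := hz.isConformalPatch hX
  set Y : ℂ → E3 := fun v => X (z.symm v)
  set N : ℂ → E3 := fun v => gaussMap X (z.symm v)
  have ht : ∀ᶠ w in 𝓝 z₀, w ∈ z.target := z.open_target.eventually_mem h₀
  have up {P : ℂ → Prop} (h : ∀ᶠ w in 𝓝 z₀, P w) : ∀ᶠ w in 𝓝[≠] z₀, P w :=
    h.filter_mono nhdsWithin_le_nhds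
  have h0 := hP.analyticAt_wdata h₀ 0
  have hI := (analyticAt_const (v := Complex.I)).mul (hP.analyticAt_wdata h₀ 1)
  by_cases h1 : N z₀ 2 = 1
  · have hne : N z₀ 2 ≠ -1 := by rw [h1]; norm_num
    have hev := (hP.continuousAt_coord h₀ 2).eventually_ne hne
    have hη (w : ℂ) (hw : w ∈ z.target) (h : N w 2 ≠ -1) :
      wdata Y 0 w + Complex.I * wdata Y 1 w ≠ 0 := fun h0 => h (hP.normal_eq_neg_one hw h0)
    refine ⟨stereoInvFun N, fun w => -1 / (2 * (wdata Y 0 w + Complex.I * wdata Y 1 w)),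
      (hP.stereoInvFun_analytic h₀ hne).1, ?_, ?_, ?_, ?_⟩
    · exact analyticAt_const.div (analyticAt_const.mul (h0.add hI))
        (mul_ne_zero two_ne_zero (hη z₀ h₀ hne))
    · exact div_ne_zero (by simp) (mul_ne_zero two_ne_zero (hη z₀ h₀ hne))
    · filter_upwards [ht, hev] with w hw hw1
      have := hη w hw hw1
      rw [hz.hopfCoeff_eq hX hw, (hP.stereoInvFun_analytic hw hw1).2]
      field_simp
    · filter_upwards [up ht, up hev, hq] with w hw hw1 hqw
      by_cases h3 : gaussMap X (z.symm w) 2 = 1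
      · rw [schwarzianGauss, if_pos h3]
        rfl
      -- Near a pole of `G` the definition switches to `G` at points that are not poles, while `f`
      -- is `1/G` throughout; invariance under inversion reconciles the two.
      · rw [schwarzianGauss, if_neg h3]
        obtain ⟨ha, hd⟩ := hP.stereoInvFun_analytic hw hw1
        have hcast (u : ℂ) (hu1 : N u 2 ≠ -1) (hu3 : N u 2 ≠ 1) :
            (1 + N u 2 : ℂ) ≠ 0 ∧ (1 - N u 2 : ℂ) ≠ 0 := by
          constructor
          · rw [← Complex.ofReal_one, ← Complex.ofReal_add]
            exact Complex.ofReal_ne_zero.mpr fun h => hu1 (by linarith)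
          · rw [← Complex.ofReal_one, ← Complex.ofReal_sub]
            exact Complex.ofReal_ne_zero.mpr fun h => hu3 (by linarith)
        have hprod (u : ℂ) (hu : u ∈ z.target) : ((N u 0 : ℂ) + Complex.I * N u 1) *
            (N u 0 - Complex.I * N u 1) = (1 - N u 2) * (1 + N u 2) := by
          have hs : (N u 0 : ℂ) ^ 2 + (N u 1 : ℂ) ^ 2 + (N u 2 : ℂ) ^ 2 = 1 := by
            have h := congrArg (fun x : ℝ => (x : ℂ)) (hP.normal_sq hu)
            push_cast at h
            exact h
          linear_combination hs - (N u 1 : ℂ) ^ 2 * Complex.I_sq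
        have hnz (u : ℂ) (hu : u ∈ z.target) (hu1 : N u 2 ≠ -1) (hu3 : N u 2 ≠ 1) :
            (N u 0 - Complex.I * N u 1 : ℂ) ≠ 0 := by
          intro h
          have := hprod u hu
          rw [h, mul_zero, eq_comm, mul_eq_zero] at this
          exact this.elim (hcast u hu1 hu3).2 (hcast u hu1 hu3).1
        refine schwarzian_inv (hz.analyticAt_gammaCoeff hX hw hqw) ha ?_ ?_ ?_
        · intro h
          rw [h, mul_zero, ← hz.hopfCoeff_eq hX hw] at hd
          exact hqw hd
        · exact div_ne_zero (hnz w hw hw1 h3) (hcast w hw1 h3).1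
        · filter_upwards [z.open_target.eventually_mem hw,
            (hP.continuousAt_coord hw 2).eventually_ne hw1,
            (hP.continuousAt_coord hw 2).eventually_ne h3] with u hu hu1 hu3
          rw [stereoInvFun, inv_div, eq_div_iff (hnz u hu hu1 hu3)]
          change (N u 0 + Complex.I * N u 1) / (1 - N u 2) * (N u 0 - Complex.I * N u 1) = _
          rw [div_mul_eq_mul_div, hprod u hu, mul_div_cancel_left₀ _ (hcast u hu1 hu3).2]
  · have hev := (hP.continuousAt_coord h₀ 2).eventually_ne h1
    have hη (w : ℂ) (hw : w ∈ z.target) (h : N w 2 ≠ 1) :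
      wdata Y 0 w - Complex.I * wdata Y 1 w ≠ 0 := fun h0 => h (hP.normal_eq_one hw h0)
    refine ⟨stereoFun N, fun w => -1 / (2 * (wdata Y 0 w - Complex.I * wdata Y 1 w)),
      (hP.stereoFun_analytic h₀ h1).1, ?_, ?_, ?_, ?_⟩
    · exact analyticAt_const.div (analyticAt_const.mul (h0.sub hI))
        (mul_ne_zero two_ne_zero (hη z₀ h₀ h1))
    · exact div_ne_zero (by simp) (mul_ne_zero two_ne_zero (hη z₀ h₀ h1))
    · filter_upwards [ht, hev] with w hw hw1
      have := hη w hw hw1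
      rw [hz.hopfCoeff_eq hX hw, (hP.stereoFun_analytic hw hw1).2]
      field_simp
    · filter_upwards [up ht, up hev] with w hw hw1
      rw [schwarzianGauss, if_neg hw1]
      rfl

/-- At an umbilic point of order `n`, a relation `P₄ = c P₂²` determines `c`. -/
theorem IsHolomorphicCoord.coeff_of_relation (hz : IsHolomorphicCoord X z)
    (hX : IsMinimalImmersion X) {z₀ : ℂ} (h₀ : z₀ ∈ z.target) {n : ℕ}
    (hord : analyticOrderAt (hopfCoeff X z) z₀ = n) {c : ℂ}
    (hc : ∀ w ∈ z.target, ¬ IsUmbilic X (z.symm w) →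
      entropyCoeff X z 4 w = c * entropyCoeff X z 2 w ^ 2) :
    3 / 2 * ((n : ℂ) + 2) ^ 2 * (-(3 * (n : ℂ) ^ 2 + 4 * n) / 8) =
      c * (-(3 * (n : ℂ) ^ 2 + 4 * n) / 8) ^ 2 := by
  have hqa := hz.analyticAt_hopfCoeff hX h₀
  have hq : ∀ᶠ w in 𝓝[≠] z₀, hopfCoeff X z w ≠ 0 := by
    refine hqa.eventually_eq_zero_or_eventually_ne_zero.resolve_left fun h => ?_
    rw [analyticOrderAt_eq_top.mpr h] at hord
    exact ENat.top_ne_natCast n hord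
  have ht : ∀ᶠ w in 𝓝[≠] z₀, w ∈ z.target :=
    (z.open_target.eventually_mem h₀).filter_mono nhdsWithin_le_nhds
  obtain ⟨f, v, hf, hv, hv0, hfv, hS⟩ := hz.exists_schwarzianGauss_eq hX h₀ hq
  have hγ : ∀ᶠ w in 𝓝[≠] z₀,
      gammaCoeff X z w = deriv (hopfCoeff X z) w / (2 * hopfCoeff X z w) := by
    filter_upwards [ht, hq] with w hw hqw using hz.gammaCoeff_eq hX hw hqw
  obtain ⟨R, A, hR, hA, hR0, hA0, hγR, hSA⟩ := schwarzian_laurent hqa hord hv hv0 hf hfv hγ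
  have hid : AnalyticAt ℂ (fun w : ℂ => w - z₀) z₀ := analyticAt_id.sub analyticAt_const
  have h2 : ∀ᶠ w in 𝓝[≠] z₀, entropyCoeff X z 2 w = A w / (w - z₀) ^ 2 := by
    filter_upwards [hS, hSA] with w h1 h2 using h1.trans h2
  set B : ℂ → ℂ := fun w => (w - z₀) * deriv A w - (2 : ℕ) * A w - (2 : ℕ) * R w * A w / 2 with hB
  have hBa : AnalyticAt ℂ B z₀ := ((hid.mul hA.deriv).sub (analyticAt_const.mul hA)).sub
    (((analyticAt_const.mul hR).mul hA).div_const)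
  have h3 : ∀ᶠ w in 𝓝[≠] z₀, entropyCoeff X z 3 w = B w / (w - z₀) ^ 3 :=
    nablaOneZero_laurent 2 hA hγR h2
  set C : ℂ → ℂ := fun w => (w - z₀) * deriv B w - (3 : ℕ) * B w - (3 : ℕ) * R w * B w / 2 with hC
  have hCa : AnalyticAt ℂ C z₀ := ((hid.mul hBa.deriv).sub (analyticAt_const.mul hBa)).sub
    (((analyticAt_const.mul hR).mul hBa).div_const)
  have h4 : ∀ᶠ w in 𝓝[≠] z₀, entropyCoeff X z 4 w = C w / (w - z₀) ^ 4 :=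
    nablaOneZero_laurent 3 hBa hγR h3
  -- Both sides of the relation have denominator `(w - z₀)⁴`, so the numerators agree off `z₀`, and
  -- by continuity at `z₀`.
  have hrel : C =ᶠ[𝓝[≠] z₀] fun w => c * A w ^ 2 := by
    filter_upwards [h2, h4, ht, hq, self_mem_nhdsWithin] with w h2w h4w hw hqw hne
    have hne' : w - z₀ ≠ 0 := sub_ne_zero.mpr hne
    have := hc w hw (fun h => hqw ((hz.isUmbilic_iff hX hw).mp h))
    rw [h2w, h4w] at this
    field_simp at this
    exact this
  have hlim := tendsto_nhds_unique_of_eventuallyEq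
    (hCa.continuousAt.tendsto.mono_left nhdsWithin_le_nhds)
    ((analyticAt_const.mul (hA.pow 2)).continuousAt.tendsto.mono_left nhdsWithin_le_nhds) hrel
  have hB0 : B z₀ = -(n + 2) * A z₀ := by
    simp only [hB, hR0]
    push_cast
    ring
  have hC0 : C z₀ = 3 / 2 * (n + 2) ^ 2 * A z₀ := by
    simp only [hC, hR0, hB0]
    push_cast
    ring
  rw [hC0] at hlim
  simp only [Pi.mul_apply, Pi.pow_apply, hA0] at hlim
  exact hlim

/-- For `k ≥ 1` the leading coefficient is nonzero and can be cancelled, which determines `c`.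
Equating the values for `m` and `n` and cross-multiplying gives `(m - n)(8nm + 12(m + n) + 16) = 0`,
whose second factor is positive. -/
theorem orders_eq_of_relation {m n : ℕ} (hm : m ≠ 0) (hn : n ≠ 0) {c : ℂ}
    (h1 : 3 / 2 * ((n : ℂ) + 2) ^ 2 * (-(3 * (n : ℂ) ^ 2 + 4 * n) / 8) =
      c * (-(3 * (n : ℂ) ^ 2 + 4 * n) / 8) ^ 2)
    (h2 : 3 / 2 * ((m : ℂ) + 2) ^ 2 * (-(3 * (m : ℂ) ^ 2 + 4 * m) / 8) =
      c * (-(3 * (m : ℂ) ^ 2 + 4 * m) / 8) ^ 2) :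
    m = n ∧ c = -(12 * ((n : ℂ) + 2) ^ 2 / (3 * (n : ℂ) ^ 2 + 4 * n)) := by
  have pos (k : ℕ) (hk : k ≠ 0) : (3 * (k : ℂ) ^ 2 + 4 * k) ≠ 0 := by
    have : (3 * k ^ 2 + 4 * k : ℕ) ≠ 0 := by positivity
    exact_mod_cast this
  have solve (k : ℕ) (hk : k ≠ 0) (h : 3 / 2 * ((k : ℂ) + 2) ^ 2 * (-(3 * (k : ℂ) ^ 2 + 4 * k) / 8) =
      c * (-(3 * (k : ℂ) ^ 2 + 4 * k) / 8) ^ 2) :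
      12 * ((k : ℂ) + 2) ^ 2 = -c * (3 * (k : ℂ) ^ 2 + 4 * k) := by
    apply mul_right_cancel₀ (pos k hk)
    linear_combination (-64) * h
  have hn' := solve n hn h1
  have hm' := solve m hm h2
  refine ⟨?_, ?_⟩
  · have hprod : ((m : ℂ) - n) * (8 * n * m + 12 * (m + n) + 16) = 0 := by
      linear_combination (1 / 12) * ((3 * (m : ℂ) ^ 2 + 4 * m) * hn' - (3 * (n : ℂ) ^ 2 + 4 * n) * hm')
    have hpos : (8 * n * m + 12 * (m + n) + 16 : ℂ) ≠ 0 := by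
      have : (8 * n * m + 12 * (m + n) + 16 : ℕ) ≠ 0 := by positivity
      exact_mod_cast this
    have := (mul_eq_zero.mp hprod).resolve_right hpos
    exact_mod_cast sub_eq_zero.mp this
  · rw [hn', neg_mul, neg_div, neg_neg, mul_div_cancel_right₀ _ (pos n hn)]

theorem IsHolomorphicCoord.eventually_umbilic_iff (hz : IsHolomorphicCoord X z)
    (hX : IsMinimalImmersion X) {p : M} (hp : p ∈ z.source) :
    (∀ᶠ p' in 𝓝 p, IsUmbilic X p') ↔ ∀ᶠ w in 𝓝 (z p), hopfCoeff X z w = 0 := by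
  have hzp := z.map_source hp
  constructor
  · intro h
    have h1 := (z.tendsto_symm hp).eventually h
    filter_upwards [h1, z.open_target.eventually_mem hzp] with w hw hwt
    exact (hz.isUmbilic_iff hX hwt).mp hw
  · intro h
    have h1 := (z.continuousAt hp).eventually h
    filter_upwards [h1, z.open_source.eventually_mem hp] with p' hp' hps
    rw [← z.left_inv hps]
    exact (hz.isUmbilic_iff hX (z.map_source hps)).mpr hp'

/-- On a connected non-flat minimal surface the umbilic points have empty interior. -/
theorem not_eventually_umbilic [ConnectedSpace M] [OrientedAtlas M] (hX : IsMinimalImmersion X)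
    (hflat : ∃ p, gaussCurvature X p ≠ 0) (p : M) : ¬ ∀ᶠ p' in 𝓝 p, IsUmbilic X p' := by
  set T : Set M := {p | ∀ᶠ p' in 𝓝 p, IsUmbilic X p'} with hT
  have hopen : IsOpen T := isOpen_setOfPred_eventually_nhds
  have hclosed : IsClosed T := by
    refine isClosed_of_closure_subset fun p hp => ?_
    obtain ⟨z, hz, hps⟩ := exists_isHolomorphicCoord hX p
    have hzp := z.map_source hps
    rcases (hz.analyticAt_hopfCoeff hX hzp).eventually_eq_zero_or_eventually_ne_zero with h | h
    · exact (hz.eventually_umbilic_iff hX hps).mpr h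
    · exfalso
      rw [eventually_nhdsWithin_iff] at h
      have h1 := (z.continuousAt hps).eventually h.eventually_nhds
      obtain ⟨t, ⟨ht1, hts⟩, htT⟩ := mem_closure_iff_nhds.mp hp _
        (h1.and (z.open_source.eventually_mem hps))
      have h2 := (hz.eventually_umbilic_iff hX hts).mp htT
      obtain ⟨O, hO, hOo, htO⟩ := eventually_nhds_iff.mp (ht1.and h2)
      -- The point `t` may be `p` itself, where nothing is known about `q` being nonzero, so a
      -- different point of the open set is used.
      obtain ⟨w, hwO, hwne⟩ := (dense_compl_singleton (z p)).inter_open_nonempty O hOo ⟨_, htO⟩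
      exact (hO w hwO).1 hwne (hO w hwO).2
  intro hp
  rcases isClopen_iff.mp ⟨hclosed, hopen⟩ with h | h
  · have hpT : p ∈ T := hp
    rw [h] at hpT
    exact hpT
  · obtain ⟨r, hr⟩ := hflat
    have hrT : r ∈ T := h ▸ Set.mem_univ r
    obtain ⟨z, hz, hrs⟩ := exists_isHolomorphicCoord hX r
    have h0 := ((hz.eventually_umbilic_iff hX hrs).mp hrT).self_of_nhds
    have hK := hz.gaussCurvature_eq hX (z.map_source hrs)
    rw [z.left_inv hrs, h0] at hK
    exact hr (by simpa using hK)

theorem DegreeRelation.exists_coeff (h : DegreeRelation X 4) :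
    ∃ c : ℂ, HoldsOffUmbilics X fun z w =>
      entropyCoeff X z 4 w = c * entropyCoeff X z 2 w ^ 2 := by
  rcases h with h | ⟨ψ, -, hψ, h⟩
  · exact ⟨0, fun z hz w hw hu => (h z hz w hw hu).trans (zero_mul _).symm⟩
  -- The support contains at most the exponent `(2, 0)`, the only solution of `2d₀ + 3d₁ = 4`, so
  -- this sum is the coefficient of `P₂²`.
  · refine ⟨∑ d ∈ ψ.support, ψ.coeff d, fun z hz w hw hu => ?_⟩
    refine (h z hz w hw hu).trans ?_
    rw [MvPolynomial.eval_eq', Finset.sum_mul]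
    refine Finset.sum_congr rfl fun d hd => ?_
    have hwt := hψ (MvPolynomial.mem_support_iff.mp hd)
    rw [Finsupp.weight_apply, Finsupp.sum_fintype _ _ (by simp)] at hwt
    have h2 : d (0 : Fin 2) * 2 + d (1 : Fin 2) * 3 = 4 :=
      (Fin.sum_univ_two (fun i : Fin 2 => d i • ((i : ℕ) + 2))).symm.trans hwt
    have hd0 : d (0 : Fin 2) = 2 := by omega
    have hd1 : d (1 : Fin 2) = 0 := by omega
    congr 1
    refine (Fin.prod_univ_two (fun i : Fin 2 => entropyCoeff X z ((i : ℕ) + 2) w ^ d i)).trans ?_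
    rw [hd0, hd1, pow_zero, mul_one]
    rfl

end Umbilics

end EntropyDifferential

end

/-! ### The main theorem. -/

theorem mainTheorem3 {M : Type*} [TopologicalSpace M] [T2Space M] [SecondCountableTopology M]
    [ConnectedSpace M] [ChartedSpace ℂ M] [IsManifold 𝓘(ℝ, ℂ) ∞ M]
    [EntropyDifferential.OrientedAtlas M]
    (X : M → EntropyDifferential.E3) (hX : EntropyDifferential.IsMinimalImmersion X)
    (hdeg : EntropyDifferential.HasDegree X 4)
    (n : ℕ) (p : M) (hp : EntropyDifferential.IsUmbilic X p)
    (hn : EntropyDifferential.HopfVanishesToOrder X p n) :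
    (∀ p' : M, EntropyDifferential.IsUmbilic X p' →
      EntropyDifferential.HopfVanishesToOrder X p' n) ∧
    EntropyDifferential.HoldsOffUmbilics X (fun z w =>
      EntropyDifferential.entropyCoeff X z 4 w +
        (12 * ((n : ℂ) + 2) ^ 2 / (3 * (n : ℂ) ^ 2 + 4 * (n : ℂ))) *
          EntropyDifferential.entropyCoeff X z 2 w ^ 2 = 0) := by
  obtain ⟨c, hc⟩ := hdeg.isLeast.1.2.exists_coeff
  -- Order zero must be excluded, since for `k = 0` the leading coefficient vanishes and the
  -- relation says nothing about `c`.
  have order_ne_zero {z : OpenPartialHomeomorph M ℂ}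
      (hz : EntropyDifferential.IsHolomorphicCoord X z) {r : M} (hr : r ∈ z.source)
      (hu : EntropyDifferential.IsUmbilic X r) {k : ℕ}
      (hk : analyticOrderAt (EntropyDifferential.hopfCoeff X z) (z r) = k) : k ≠ 0 := by
    rintro rfl
    have ha := hz.analyticAt_hopfCoeff hX (z.map_source hr)
    rw [Nat.cast_zero, ha.analyticOrderAt_eq_zero] at hk
    rw [← z.left_inv hr, hz.isUmbilic_iff hX (z.map_source hr)] at hu
    exact hk hu
  obtain ⟨z, hz, hpz, -, hord⟩ := hn
  have hn0 := order_ne_zero hz hpz hp hord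
  have hrel := hz.coeff_of_relation hX (z.map_source hpz) hord (hc z hz)
  refine ⟨fun p' hp' => ?_, fun z' hz' w hw hu => ?_⟩
  · obtain ⟨z', hz', hpz'⟩ := EntropyDifferential.exists_isHolomorphicCoord hX p'
    have ha := hz'.analyticAt_hopfCoeff hX (z'.map_source hpz')
    have htop : analyticOrderAt (EntropyDifferential.hopfCoeff X z') (z' p') ≠ ⊤ := fun h =>
      EntropyDifferential.not_eventually_umbilic hX hdeg.nonflat p'
        ((hz'.eventually_umbilic_iff hX hpz').mpr (analyticOrderAt_eq_top.mp h))
    obtain ⟨m, hm⟩ := ENat.ne_top_iff_exists.mp htop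
    have hm0 := order_ne_zero hz' hpz' hp' hm.symm
    have hrel' := hz'.coeff_of_relation hX (z'.map_source hpz') hm.symm (hc z' hz')
    have hmn := (EntropyDifferential.orders_eq_of_relation hm0 hn0 hrel hrel').1
    exact ⟨z', hz', hpz', ha, by rw [← hm, hmn]⟩
  · have hcn := (EntropyDifferential.orders_eq_of_relation hn0 hn0 hrel hrel).2
    have h4 := hc z' hz' w hw hu
    beta_reduce at h4 ⊢
    rw [h4, hcn]
    ring
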